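/- Conventions. A metric space $X$ is geodesic if any two points $x,y$ are joined by a geodesic segment, i.e. an isometric embedding $[0,d(x,y)]\to X$ starting at $x$ and ending at $y$; a subset is convex if it is a geodesic space in the restricted metric. A geodesic space is CAT(0) if the distance of any two points on a geodesic triangle is at most the distance of the corresponding points of a comparison triangle in $\mathbb{R}^2$. The tangent cone $T_pX$ at a point $p$ of a CAT(0) space $X$ is the Euclidean cone (with tip) over the space of directions $\Sigma_p$, where $\Sigma_p$ is the completion of the metric space of nontrivial geodesic segments emanating from $p$ whose distance is the angle between them (segments at angle zero being identified); the cone metric is $d\big((\alpha,t),(\beta,s)\big)^2=t^2+s^2-2ts\cos d_{\Sigma_p}(\alpha,\beta)$. A Hilbert–Hadamard space is a nonempty complete geodesic CAT(0) space all of whose tangent cones embed isometrically into Hilbert spaces. A separable Hilbert–Hadamard space is admissible if it contains an increasing sequence of closed convex subsets whose union is dense and each of which, in the restricted metric, is isometric to a finite-dimensional smooth Riemannian manifold without boundary. A measure space $(Y,\mu)$ is separable if there is a countable family $\{A_n\}$ of measurable sets such that for every measurable $A\subseteq Y$ and every $\varepsilon>0$ there is an $n$ with $\mu(A\mathbin{\triangle}A_n)<\varepsilon$.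 For a finite measure space $(Y,\mu)$ and a nonempty metric space $X$, the continuum product $L^2(Y,\mu,X)$ is the set of almost-everywhere classes of strongly measurable maps $\xi\colon Y\to X$ (if $X$ is separable: of measurable maps) with $\int_Y d(\xi(y),x_0)^2\,d\mu(y)<\infty$ for some, equivalently every, $x_0\in X$, with the metric $d(\xi,\eta)=\big(\int_Y d(\xi(y),\eta(y))^2\,d\mu(y)\big)^{1/2}$. Proposition. Let $M$ be a Hilbert–Hadamard space and $(Y,\mu)$ a finite measure space. Then 1. the continuum product $L^2(Y,\mu,M)$ is again a Hilbert–Hadamard space; 2. if $(Y,\mu)$ is separable and $M$ is admissible (respectively, separable), then $L^2(Y,\mu,M)$ is admissible (respectively, separable). -/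

import Mathlib

open MeasureTheory Filter Topology Set
open scoped Manifold ContDiff Bundle

noncomputable section

universe u

namespace HilbertHadamard

/-! ### Geodesics and CAT(0) spaces -/

section Geodesic

variable {X : Type*} [MetricSpace X]

/-- `γ`, restricted to `[0, d(x, y)]`, is a geodesic segment from `x` to `y`, parametrized by arc
length. (The values of `γ` outside `[0, d(x, y)]` are irrelevant.) -/
structure IsGeodesicSegment (γ : ℝ → X) (x y : X) : Prop where
  source : γ 0 = x
  target : γ (dist x y) = y
  dist_eq : ∀ s ∈ Icc 0 (dist x y), ∀ t ∈ Icc 0 (dist x y), dist (γ s) (γ t) = |s - t|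

variable (X) in
/-- Any two points are joined by a geodesic segment. -/
def IsGeodesicSpace : Prop :=
  ∀ x y : X, ∃ γ : ℝ → X, IsGeodesicSegment γ x y

/-- The point `z` lies on some geodesic segment from `x` to `y`. -/
def LiesOnGeodesic (x y z : X) : Prop :=
  ∃ γ : ℝ → X, IsGeodesicSegment γ x y ∧ ∃ t ∈ Icc 0 (dist x y), γ t = z

variable (X) in
/-- A geodesic space is CAT(0) if its geodesic triangles are at least as thin as their comparison
triangles in the Euclidean plane. Here `x` and `y` lie on two sides of a geodesic triangle with
vertices `p, q, r`, the name `p` being given to the common vertex of these two sides; `p' q' r'` is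
a comparison triangle and `x'`, `y'` are the points corresponding to `x`, `y`. (For two points on
one and the same side there is nothing to require.) -/
structure IsCAT0 : Prop where
  geodesic : IsGeodesicSpace X
  thin : ∀ p q r x y : X, LiesOnGeodesic p q x → LiesOnGeodesic p r y →
    ∀ p' q' r' x' y' : EuclideanSpace ℝ (Fin 2),
      dist p' q' = dist p q → dist p' r' = dist p r → dist q' r' = dist q r →
      x' ∈ segment ℝ p' q' → dist p' x' = dist p x →
      y' ∈ segment ℝ p' r' → dist p' y' = dist p y →
      dist x y ≤ dist x' y'

/-- The comparison angle at `y` of three points `x, y, z` with `x ≠ y ≠ z`. -/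
def comparisonAngle (x y z : X) : ℝ :=
  Real.arccos ((dist x y ^ 2 + dist y z ^ 2 - dist x z ^ 2) / (2 * dist x y * dist y z))

/-- A nontrivial geodesic segment emanating from `p`, parametrized by arc length on
`[0, length]`. (The values outside `[0, length]` are irrelevant.) -/
structure GeodesicFrom (p : X) where
  length : ℝ
  length_pos : 0 < length
  toFun : ℝ → X
  map_zero : toFun 0 = p
  dist_eq : ∀ s ∈ Icc 0 length, ∀ t ∈ Icc 0 length, dist (toFun s) (toFun t) = |s - t|

namespace GeodesicFrom

variable {p : X}

/-- The angle between two geodesic segments emanating from `p`: the limit of the comparison angles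
`∠(α(s), p, β(t))` as `s, t → 0+`. It is written as an upper limit, which is the limit
whenever the limit exists, in particular in every CAT(0) space. -/
def angle (α β : GeodesicFrom p) : ℝ :=
  limsup (fun st : ℝ × ℝ => comparisonAngle (α.toFun st.1) p (β.toFun st.2))
    (𝓝[>] 0 ×ˢ 𝓝[>] 0)

lemma dist_base (α : GeodesicFrom p) {s : ℝ} (hs : s ∈ Ioc 0 α.length) :
    dist (α.toFun s) p = s := by
  have h := α.dist_eq s ⟨hs.1.le, hs.2⟩ 0 ⟨le_rfl, α.length_pos.le⟩
  rw [α.map_zero, sub_zero, abs_of_pos hs.1] at h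
  exact h

lemma comparisonAngle_nonneg (x y z : X) : 0 ≤ comparisonAngle x y z := Real.arccos_nonneg _

lemma comparisonAngle_le_pi (x y z : X) : comparisonAngle x y z ≤ Real.pi := Real.arccos_le_pi _

lemma comparisonAngle_comm (x y z : X) : comparisonAngle x y z = comparisonAngle z y x := by
  unfold comparisonAngle
  rw [dist_comm x y, dist_comm y z, dist_comm x z]
  congr 1
  ring

/-- Law of cosines for the comparison angle. -/
lemma dist_sq_eq (x y z : X) (hx : x ≠ y) (hz : y ≠ z) :
    dist x z ^ 2 = dist x y ^ 2 + dist y z ^ 2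
      - 2 * dist x y * dist y z * Real.cos (comparisonAngle x y z) := by
  have h1 : 0 < dist x y := dist_pos.2 hx
  have h2 : 0 < dist y z := dist_pos.2 hz
  have t1 := dist_triangle x y z
  have t2 := dist_triangle x z y
  have t3 := dist_triangle y x z
  rw [dist_comm z y] at t2
  rw [dist_comm y x] at t3
  have h3 : 0 ≤ dist x z := dist_nonneg
  unfold comparisonAngle
  rw [Real.cos_arccos]
  · field_simp
    ring
  · rw [le_div_iff₀ (by positivity)]
    nlinarith
  · rw [div_le_iff₀ (by positivity)]
    have : |dist x y - dist y z| ≤ dist x z := abs_le.2 ⟨by linarith, by linarith⟩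
    nlinarith [sq_le_sq' (by linarith [abs_nonneg (dist x y - dist y z)]) this,
      sq_abs (dist x y - dist y z)]

lemma eventually_Ioc (α : GeodesicFrom p) {e : ℝ} (he : 0 < e) :
    ∀ᶠ s in 𝓝[>] (0 : ℝ), s ∈ Ioc 0 α.length ∧ s < e := by
  filter_upwards [Ioo_mem_nhdsGT (lt_min α.length_pos he)] with s hs
  exact ⟨⟨hs.1, (hs.2.trans_le (min_le_left _ _)).le⟩, hs.2.trans_le (min_le_right _ _)⟩

lemma bdd (α β : GeodesicFrom p) : IsBoundedUnder (· ≤ ·) (𝓝[>] (0 : ℝ) ×ˢ 𝓝[>] (0 : ℝ))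
    (fun st : ℝ × ℝ => comparisonAngle (α.toFun st.1) p (β.toFun st.2)) :=
  isBoundedUnder_of ⟨Real.pi, fun _ => comparisonAngle_le_pi _ _ _⟩

lemma bdd' (α β : GeodesicFrom p) : IsBoundedUnder (· ≥ ·) (𝓝[>] (0 : ℝ) ×ˢ 𝓝[>] (0 : ℝ))
    (fun st : ℝ × ℝ => comparisonAngle (α.toFun st.1) p (β.toFun st.2)) :=
  isBoundedUnder_of ⟨0, fun _ => comparisonAngle_nonneg _ _ _⟩

lemma angle_le_of_eventually (α β : GeodesicFrom p) {a : ℝ}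
    (h : ∀ᶠ st : ℝ × ℝ in 𝓝[>] 0 ×ˢ 𝓝[>] 0,
      comparisonAngle (α.toFun st.1) p (β.toFun st.2) ≤ a) : angle α β ≤ a :=
  limsup_le_of_le (bdd' α β).isCoboundedUnder_le h

lemma angle_le_pi (α β : GeodesicFrom p) : angle α β ≤ Real.pi :=
  angle_le_of_eventually α β (Eventually.of_forall fun _ => comparisonAngle_le_pi _ _ _)

lemma angle_nonneg (α β : GeodesicFrom p) : 0 ≤ angle α β :=
  le_limsup_of_frequently_le
    (Eventually.frequently (Eventually.of_forall fun _ => comparisonAngle_nonneg _ _ _)) (bdd α β)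

lemma angle_self (α : GeodesicFrom p) : angle α α = 0 := by
  refine le_antisymm (angle_le_of_eventually α α ?_) (angle_nonneg α α)
  filter_upwards [(α.eventually_Ioc one_pos).prod_mk (α.eventually_Ioc one_pos)] with st h
  obtain ⟨⟨h1, -⟩, ⟨h2, -⟩⟩ := h
  have d1 := α.dist_base h1
  have d2 := α.dist_base h2
  have d3 := α.dist_eq _ ⟨h1.1.le, h1.2⟩ _ ⟨h2.1.le, h2.2⟩
  unfold comparisonAngle
  rw [dist_comm p, d1, d2, d3, sq_abs]
  have : (st.1 ^ 2 + st.2 ^ 2 - (st.1 - st.2) ^ 2) / (2 * st.1 * st.2) = 1 := by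
    have := h1.1.ne'
    have := h2.1.ne'
    field_simp
    ring
  rw [this, Real.arccos_one]

lemma angle_comm (α β : GeodesicFrom p) : angle α β = angle β α := by
  unfold angle
  conv_lhs => rw [prod_comm, limsup, map_map]
  exact congrArg (fun f => limsSup (map f _)) (funext fun _ => comparisonAngle_comm _ _ _)

/-- The planar computation behind the triangle inequality for angles. -/
lemma exists_planar {A B s t : ℝ} (hA : 0 < A) (hB : 0 < B) (hAB : A + B < Real.pi)
    (hs : 0 < s) (ht : 0 < t) : ∃ r, 0 < r ∧ r ≤ max s t ∧
      √(s ^ 2 + r ^ 2 - 2 * s * r * Real.cos A) + √(r ^ 2 + t ^ 2 - 2 * r * t * Real.cos B)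
        = √(s ^ 2 + t ^ 2 - 2 * s * t * Real.cos (A + B)) := by
  have sA : 0 < Real.sin A := Real.sin_pos_of_pos_of_lt_pi hA (by linarith)
  have sB : 0 < Real.sin B := Real.sin_pos_of_pos_of_lt_pi hB (by linarith)
  have sAB : 0 < Real.sin (A + B) := Real.sin_pos_of_pos_of_lt_pi (by linarith) hAB
  have eA := Real.sin_sq_add_cos_sq A
  have eB := Real.sin_sq_add_cos_sq B
  have cA := Real.cos_le_one A
  have cB := Real.cos_le_one B
  rw [Real.sin_add] at sAB
  rw [Real.cos_add]
  generalize Real.sin A = a at *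
  generalize Real.sin B = b at *
  generalize Real.cos A = c at *
  generalize Real.cos B = d at *
  obtain ⟨D, hD⟩ : ∃ D, D = s * a + t * b := ⟨_, rfl⟩
  have hDpos : 0 < D := by rw [hD]; positivity
  obtain ⟨l, hl⟩ : ∃ l, l = t * b / D := ⟨_, rfl⟩
  have hl' : 1 - l = s * a / D := by
    rw [hl, hD]; rw [hD] at hDpos; field_simp; ring
  have hl0 : 0 < l := by rw [hl]; positivity
  have hl1 : 0 < 1 - l := by rw [hl']; positivity
  have key : l * (s * a) = (1 - l) * (t * b) := by rw [hl', hl]; ring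
  have hr : l * (s * c) + (1 - l) * (t * d) = s * t * (a * d + c * b) / D := by
    rw [hl', hl]; ring
  refine ⟨l * (s * c) + (1 - l) * (t * d), ?_, ?_, ?_⟩
  · rw [hr]; positivity
  · have h1 : s * c ≤ max s t := (mul_le_of_le_one_right hs.le cA).trans (le_max_left _ _)
    have h2 : t * d ≤ max s t := (mul_le_of_le_one_right ht.le cB).trans (le_max_right _ _)
    nlinarith
  · obtain ⟨Q, hQ⟩ : ∃ Q, Q = s ^ 2 + t ^ 2 - 2 * s * t * (c * d - a * b) := ⟨_, rfl⟩
    have hQ' : Q = (s * c - t * d) ^ 2 + (s * a + t * b) ^ 2 := by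
      rw [hQ]; linear_combination -s ^ 2 * eA - t ^ 2 * eB
    have e1 : s ^ 2 + (l * (s * c) + (1 - l) * (t * d)) ^ 2
        - 2 * s * (l * (s * c) + (1 - l) * (t * d)) * c = (1 - l) ^ 2 * Q := by
      rw [hQ']
      have : s * a = (1 - l) * (s * a + t * b) := by linear_combination key
      have h2 : (1 - l) ^ 2 * (s * a + t * b) ^ 2 = (s * a) ^ 2 := by
        rw [← mul_pow, ← this]
      linear_combination -h2 - s ^ 2 * eA
    have e2 : (l * (s * c) + (1 - l) * (t * d)) ^ 2 + t ^ 2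
        - 2 * (l * (s * c) + (1 - l) * (t * d)) * t * d = l ^ 2 * Q := by
      rw [hQ']
      have : t * b = l * (s * a + t * b) := by linear_combination -key
      have h2 : l ^ 2 * (s * a + t * b) ^ 2 = (t * b) ^ 2 := by
        rw [← mul_pow, ← this]
      linear_combination -h2 - t ^ 2 * eB
    rw [e1, e2, ← hQ, Real.sqrt_mul (by positivity), Real.sqrt_mul (by positivity),
      Real.sqrt_sq hl0.le, Real.sqrt_sq hl1.le]
    ring

lemma angle_triangle (α β γ : GeodesicFrom p) : angle α γ ≤ angle α β + angle β γ := by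
  refine le_of_forall_pos_le_add fun e he => ?_
  obtain ⟨A, hA⟩ : ∃ A, A = angle α β + e / 2 := ⟨_, rfl⟩
  obtain ⟨B, hB⟩ : ∃ B, B = angle β γ + e / 2 := ⟨_, rfl⟩
  have hA0 : 0 < A := by have := angle_nonneg α β; linarith
  have hB0 : 0 < B := by have := angle_nonneg β γ; linarith
  have hsum : angle α β + angle β γ + e = A + B := by rw [hA, hB]; ring
  rw [hsum]
  rcases le_or_gt Real.pi (A + B) with hAB | hAB
  · exact (angle_le_pi α γ).trans hAB
  have h1 : ∀ᶠ st : ℝ × ℝ in 𝓝[>] 0 ×ˢ 𝓝[>] 0,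
      comparisonAngle (α.toFun st.1) p (β.toFun st.2) < A :=
    eventually_lt_of_limsup_lt (show angle α β < A by linarith) (bdd α β)
  have h2 : ∀ᶠ st : ℝ × ℝ in 𝓝[>] 0 ×ˢ 𝓝[>] 0,
      comparisonAngle (β.toFun st.1) p (γ.toFun st.2) < B :=
    eventually_lt_of_limsup_lt (show angle β γ < B by linarith) (bdd β γ)
  have basis := (nhdsGT_basis (0 : ℝ)).prod_self
  obtain ⟨e1, he1, h1⟩ := basis.eventually_iff.1 h1
  obtain ⟨e2, he2, h2⟩ := basis.eventually_iff.1 h2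
  have he3 : 0 < min (min e1 e2) β.length := lt_min (lt_min he1 he2) β.length_pos
  apply angle_le_of_eventually
  filter_upwards [(α.eventually_Ioc he3).prod_mk (γ.eventually_Ioc he3)] with st h
  obtain ⟨⟨hs, hs'⟩, ⟨ht, ht'⟩⟩ := h
  obtain ⟨s, t⟩ := st
  simp only at hs hs' ht ht' ⊢
  obtain ⟨r, hr0, hrm, hr⟩ := exists_planar hA0 hB0 hAB hs.1 ht.1
  have hr' : r < min (min e1 e2) β.length := hrm.trans_lt (max_lt hs' ht')
  rw [lt_min_iff, lt_min_iff] at hs' ht' hr'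
  have hrI : r ∈ Ioc 0 β.length := ⟨hr0, hr'.2.le⟩
  have c1 := h1 (x := (s, r)) ⟨⟨hs.1, hs'.1.1⟩, ⟨hr0, hr'.1.1⟩⟩
  have c2 := h2 (x := (r, t)) ⟨⟨hr0, hr'.1.2⟩, ⟨ht.1, ht'.1.2⟩⟩
  simp only at c1 c2
  have ds := α.dist_base hs
  have dr := β.dist_base hrI
  have dt := γ.dist_base ht
  have ns : α.toFun s ≠ p := dist_pos.1 (hs.1.trans_eq ds.symm)
  have nr : β.toFun r ≠ p := dist_pos.1 (hr0.trans_eq dr.symm)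
  have nt : γ.toFun t ≠ p := dist_pos.1 (ht.1.trans_eq dt.symm)
  have l1 := dist_sq_eq _ _ _ ns nr.symm
  have l2 := dist_sq_eq _ _ _ nr nt.symm
  have l3 := dist_sq_eq _ _ _ ns nt.symm
  rw [ds, dist_comm p, dr] at l1
  rw [dr, dist_comm p, dt] at l2
  rw [ds, dist_comm p, dt] at l3
  have k1 : Real.cos A ≤ Real.cos (comparisonAngle (α.toFun s) p (β.toFun r)) :=
    Real.cos_le_cos_of_nonneg_of_le_pi (comparisonAngle_nonneg _ _ _) (by linarith) c1.le
  have k2 : Real.cos B ≤ Real.cos (comparisonAngle (β.toFun r) p (γ.toFun t)) :=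
    Real.cos_le_cos_of_nonneg_of_le_pi (comparisonAngle_nonneg _ _ _) (by linarith) c2.le
  have m1 : dist (α.toFun s) (β.toFun r) ≤ √(s ^ 2 + r ^ 2 - 2 * s * r * Real.cos A) := by
    apply Real.le_sqrt_of_sq_le
    have : 0 ≤ 2 * s * r := by have := hs.1; positivity
    linarith [mul_le_mul_of_nonneg_left k1 this]
  have m2 : dist (β.toFun r) (γ.toFun t) ≤ √(r ^ 2 + t ^ 2 - 2 * r * t * Real.cos B) := by
    apply Real.le_sqrt_of_sq_le
    have : 0 ≤ 2 * r * t := by have := ht.1; positivity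
    linarith [mul_le_mul_of_nonneg_left k2 this]
  have m3 : dist (α.toFun s) (γ.toFun t) ≤ √(s ^ 2 + t ^ 2 - 2 * s * t * Real.cos (A + B)) := by
    rw [← hr]
    exact (dist_triangle _ _ _).trans (add_le_add m1 m2)
  have hst : 0 < 2 * s * t := by have := hs.1; have := ht.1; positivity
  have nn : 0 ≤ s ^ 2 + t ^ 2 - 2 * s * t * Real.cos (A + B) := by
    have := Real.cos_le_one (A + B)
    nlinarith [sq_nonneg (s - t)]
  have m4 := (Real.le_sqrt dist_nonneg nn).1 m3
  rw [l3] at m4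
  have k3 : Real.cos (A + B) ≤ Real.cos (comparisonAngle (α.toFun s) p (γ.toFun t)) := by
    by_contra hcon
    push Not at hcon
    have := mul_lt_mul_of_pos_left hcon hst
    linarith
  by_contra hcon
  push Not at hcon
  exact absurd k3 (not_le.2 (Real.cos_lt_cos_of_nonneg_of_le_pi (by linarith)
    (comparisonAngle_le_pi _ _ _) hcon))

/-- The pseudometric on the geodesic segments emanating from `p` is the angle. -/
instance : PseudoMetricSpace (GeodesicFrom p) where
  dist := angle
  dist_self := angle_self
  dist_comm := angle_comm
  dist_triangle := angle_triangle

lemma dist_def (α β : GeodesicFrom p) : dist α β = angle α β := rfl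

end GeodesicFrom

/-- The space of directions at `p`: geodesic segments emanating from `p` are identified if they have
angle zero, and the resulting metric space is completed. -/
abbrev SpaceOfDirections (p : X) : Type _ :=
  UniformSpace.Completion (SeparationQuotient (GeodesicFrom p))

end Geodesic

/-! ### Metric cones and tangent cones -/

/-- The cone `S × [0, ∞) / S × {0}` over `S`: its points are the tip, which is present also if `S` is
empty, and the pairs `(v, r)` with `v` in `S` and `r > 0`. -/
inductive MetricCone (S : Type*) where
  | tip : MetricCone S
  | ray (v : S) (r : ℝ) (hr : 0 < r) : MetricCone S

namespace MetricCone

variable {S : Type*}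

/-- The distance from the tip. -/
def radius : MetricCone S → ℝ
  | tip => 0
  | ray _ r _ => r

lemma radius_nonneg (a : MetricCone S) : 0 ≤ a.radius := by
  cases a with
  | tip => exact le_rfl
  | ray v r hr => exact hr.le

variable [MetricSpace S]

/-- The angle of two points seen from the tip; it is irrelevant if one of the points is the tip. -/
def angle : MetricCone S → MetricCone S → ℝ
  | ray v _ _, ray w _ _ => min (dist v w) Real.pi
  | _, _ => 0

lemma angle_nonneg (a b : MetricCone S) : 0 ≤ angle a b := by
  cases a <;> cases b <;> simp [angle, Real.pi_pos.le]

lemma angle_le_pi (a b : MetricCone S) : angle a b ≤ Real.pi := by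
  cases a <;> cases b <;> simp [angle, Real.pi_pos.le]

/-- The distance in the cone, given by the law of cosines. -/
def coneDist (a b : MetricCone S) : ℝ :=
  √(a.radius ^ 2 + b.radius ^ 2 - 2 * a.radius * b.radius * Real.cos (angle a b))

lemma coneDist_tip_left (b : MetricCone S) : coneDist tip b = b.radius := by
  simp [coneDist, show (tip : MetricCone S).radius = 0 from rfl, Real.sqrt_sq (radius_nonneg b)]

lemma coneDist_tip_right (a : MetricCone S) : coneDist a tip = a.radius := by
  simp [coneDist, show (tip : MetricCone S).radius = 0 from rfl, Real.sqrt_sq (radius_nonneg a)]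

lemma coneDist_comm (a b : MetricCone S) : coneDist a b = coneDist b a := by
  have : angle a b = angle b a := by
    cases a <;> cases b <;> simp [angle, dist_comm]
  unfold coneDist
  rw [this]
  congr 1
  ring

lemma coneDist_le (a b : MetricCone S) : coneDist a b ≤ a.radius + b.radius := by
  have ha := radius_nonneg a
  have hb := radius_nonneg b
  refine Real.sqrt_le_iff.2 ⟨by positivity, ?_⟩
  nlinarith [Real.neg_one_le_cos (angle a b), mul_nonneg ha hb]

lemma sub_le_coneDist (a b : MetricCone S) : a.radius - b.radius ≤ coneDist a b := by
  have ha := radius_nonneg a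
  have hb := radius_nonneg b
  refine Real.le_sqrt_of_sq_le ?_
  nlinarith [Real.cos_le_one (angle a b), mul_nonneg ha hb]

lemma sqrt_law_of_cosines_triangle {r s t A B : ℝ} :
    √(r ^ 2 + t ^ 2 - 2 * r * t * Real.cos (A + B))
      ≤ √(r ^ 2 + s ^ 2 - 2 * r * s * Real.cos A) + √(s ^ 2 + t ^ 2 - 2 * s * t * Real.cos B) := by
  have e (x y C D : ℝ) : √(x ^ 2 + y ^ 2 - 2 * x * y * Real.cos (C + D))
      = dist (!₂[x * Real.cos C, x * Real.sin C] : EuclideanSpace ℝ (Fin 2))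
          !₂[y * Real.cos D, -(y * Real.sin D)] := by
    rw [EuclideanSpace.dist_eq]
    simp only [Fin.sum_univ_two, Real.dist_eq, sq_abs, Matrix.cons_val_zero,
      Matrix.cons_val_one]
    congr 1
    rw [Real.cos_add]
    linear_combination -x ^ 2 * Real.sin_sq_add_cos_sq C - y ^ 2 * Real.sin_sq_add_cos_sq D
  have h := dist_triangle (!₂[r * Real.cos A, r * Real.sin A] : EuclideanSpace ℝ (Fin 2))
    !₂[s * Real.cos 0, -(s * Real.sin 0)] !₂[t * Real.cos B, -(t * Real.sin B)]
  rw [← e, ← e, add_zero] at h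
  have e2 := e s t 0 B
  rw [zero_add] at e2
  rw [e2]
  simpa using h

lemma coneDist_triangle (a b c : MetricCone S) : coneDist a c ≤ coneDist a b + coneDist b c := by
  cases b with
  | tip => rw [coneDist_tip_left, coneDist_tip_right]; exact coneDist_le a c
  | ray v s hs =>
    cases a with
    | tip =>
      rw [coneDist_tip_left, coneDist_tip_left]
      have := sub_le_coneDist c (ray v s hs)
      rw [coneDist_comm] at this
      linarith
    | ray u r hr =>
      cases c with
      | tip =>
        rw [coneDist_tip_right, coneDist_tip_right]
        have := sub_le_coneDist (ray u r hr) (ray v s hs)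
        linarith
      | ray w t ht =>
        simp only [coneDist, angle, radius]
        obtain ⟨A, hA⟩ : ∃ A, A = min (dist u v) Real.pi := ⟨_, rfl⟩
        obtain ⟨B, hB⟩ : ∃ B, B = min (dist v w) Real.pi := ⟨_, rfl⟩
        obtain ⟨C, hC⟩ : ∃ C, C = min (dist u w) Real.pi := ⟨_, rfl⟩
        rw [← hA, ← hB, ← hC]
        have hπ := Real.pi_pos
        have hA0 : 0 ≤ A := by rw [hA]; exact le_min dist_nonneg hπ.le
        have hB0 : 0 ≤ B := by rw [hB]; exact le_min dist_nonneg hπ.le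
        have hC0 : 0 ≤ C := by rw [hC]; exact le_min dist_nonneg hπ.le
        have hAπ : A ≤ Real.pi := by rw [hA]; exact min_le_right _ _
        have hBπ : B ≤ Real.pi := by rw [hB]; exact min_le_right _ _
        have hCπ : C ≤ Real.pi := by rw [hC]; exact min_le_right _ _
        have hCAB : C ≤ A + B := by
          have h1 := dist_triangle u v w
          rcases le_total Real.pi (dist u v) with h | h
          · rw [min_eq_right h] at hA; linarith
          rcases le_total Real.pi (dist v w) with h' | h'
          · rw [min_eq_right h'] at hB; linarith
          rw [min_eq_left h] at hA
          rw [min_eq_left h'] at hB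
          rw [hC, hA, hB]
          exact (min_le_left _ _).trans h1
        obtain ⟨B', hB'⟩ : ∃ B', B' = min B (Real.pi - A) := ⟨_, rfl⟩
        have hB'0 : 0 ≤ B' := by rw [hB']; exact le_min hB0 (by linarith)
        have hB'B : B' ≤ B := by rw [hB']; exact min_le_left _ _
        have hB'π : A + B' ≤ Real.pi := by
          have : B' ≤ Real.pi - A := by rw [hB']; exact min_le_right _ _
          linarith
        have hCB' : C ≤ A + B' := by
          rcases le_total B (Real.pi - A) with h | h
          · rw [hB', min_eq_left h]; exact hCAB
          · rw [hB', min_eq_right h]; linarith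
        have c1 : Real.cos (A + B') ≤ Real.cos C :=
          Real.cos_le_cos_of_nonneg_of_le_pi hC0 hB'π hCB'
        have c2 : Real.cos B ≤ Real.cos B' :=
          Real.cos_le_cos_of_nonneg_of_le_pi hB'0 hBπ hB'B
        have hrt : 0 < 2 * r * t := by positivity
        have hst : 0 < 2 * s * t := by positivity
        calc √(r ^ 2 + t ^ 2 - 2 * r * t * Real.cos C)
            ≤ √(r ^ 2 + t ^ 2 - 2 * r * t * Real.cos (A + B')) := by gcongr
          _ ≤ √(r ^ 2 + s ^ 2 - 2 * r * s * Real.cos A)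
              + √(s ^ 2 + t ^ 2 - 2 * s * t * Real.cos B') := sqrt_law_of_cosines_triangle
          _ ≤ _ := by gcongr

lemma eq_of_coneDist_eq_zero {a b : MetricCone S} (h : coneDist a b = 0) : a = b := by
  cases a with
  | tip =>
    cases b with
    | tip => rfl
    | ray w t ht => rw [coneDist_tip_left] at h; exact absurd h ht.ne'
  | ray v r hr =>
    cases b with
    | tip => rw [coneDist_tip_right] at h; exact absurd h hr.ne'
    | ray w t ht =>
      simp only [coneDist, angle, radius] at h
      have hc := Real.cos_le_one (min (dist v w) Real.pi)
      have hrt : 0 < r * t := by positivity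
      have h0 := Real.sqrt_eq_zero'.1 h
      have hcos : Real.cos (min (dist v w) Real.pi) = 1 := by
        refine le_antisymm hc ?_
        by_contra hcon
        push Not at hcon
        nlinarith [sq_nonneg (r - t), mul_pos hrt (sub_pos.2 hcon)]
      have hrt' : r = t := by
        rw [hcos] at h0
        have : (r - t) ^ 2 ≤ 0 := by linarith
        nlinarith [sq_nonneg (r - t), pow_eq_zero_iff (two_ne_zero) |>.1
          (le_antisymm this (sq_nonneg (r - t)))]
      have hmin : min (dist v w) Real.pi = 0 := by
        rw [← Real.arccos_cos (le_min dist_nonneg Real.pi_pos.le) (min_le_right _ _), hcos,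
          Real.arccos_one]
      have hvw : v = w := by
        rcases min_choice (dist v w) Real.pi with h' | h'
        · exact dist_eq_zero.1 (h'.symm.trans hmin)
        · exact absurd (h'.symm.trans hmin) Real.pi_pos.ne'
      subst hvw hrt'
      rfl

instance : MetricSpace (MetricCone S) where
  dist := coneDist
  dist_self a := by
    cases a with
    | tip => simp [coneDist_tip_left, radius]
    | ray v r hr =>
      simp only [coneDist, angle, radius, dist_self, min_eq_left Real.pi_pos.le, Real.cos_zero]
      rw [show r ^ 2 + r ^ 2 - 2 * r * r * 1 = 0 by ring, Real.sqrt_zero]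
  dist_comm := coneDist_comm
  dist_triangle := coneDist_triangle
  eq_of_dist_eq_zero := eq_of_coneDist_eq_zero

lemma dist_def (a b : MetricCone S) : dist a b = coneDist a b := rfl

end MetricCone

/-- The tangent cone at a point `p`. -/
abbrev TangentCone {X : Type*} [MetricSpace X] (p : X) : Type _ :=
  MetricCone (SpaceOfDirections p)

/-! ### Hilbert--Hadamard spaces -/

/-- A Hilbert--Hadamard space: a (nonempty) complete geodesic CAT(0) metric space all of whose tangent
cones embed isometrically into Hilbert spaces. -/
structure IsHilbertHadamard (X : Type u) [MetricSpace X] : Prop where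
  nonempty : Nonempty X
  complete : CompleteSpace X
  cat0 : IsCAT0 X
  tangentCone : ∀ p : X, ∃ (H : Type u) (_ : NormedAddCommGroup H) (_ : InnerProductSpace ℝ H)
    (_ : CompleteSpace H) (f : TangentCone p → H), Isometry f

/-- `N` carries the structure of a smooth finite-dimensional Riemannian manifold without boundary whose
Riemannian distance is the given distance of `N`. -/
def IsFiniteDimensionalRiemannian (N : Type*) [EMetricSpace N] : Prop :=
  ∃ (E : Type) (_ : NormedAddCommGroup E) (_ : NormedSpace ℝ E) (_ : FiniteDimensional ℝ E)
    (_ : ChartedSpace E N) (_ : IsManifold 𝓘(ℝ, E) ∞ N)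
    (_ : Bundle.RiemannianBundle (fun x : N => TangentSpace 𝓘(ℝ, E) x)),
    IsContMDiffRiemannianBundle 𝓘(ℝ, E) ∞ E (fun x : N => TangentSpace 𝓘(ℝ, E) x) ∧
    IsRiemannianManifold 𝓘(ℝ, E) N

/-- A separable Hilbert--Hadamard space is admissible if it has an increasing sequence of closed convex
subsets, isometric to finite-dimensional Riemannian manifolds, with dense union. A subset is convex
if it is a geodesic space in the restricted metric. -/
structure IsAdmissible (X : Type u) [MetricSpace X] : Prop where
  hilbertHadamard : IsHilbertHadamard X
  separable : TopologicalSpace.SeparableSpace X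
  exists_sequence : ∃ S : ℕ → Set X, Monotone S ∧
    (∀ n, IsClosed (S n)) ∧ (∀ n, IsGeodesicSpace (S n)) ∧
    (∀ n, ∃ (N : Type u) (_ : EMetricSpace N),
      IsFiniteDimensionalRiemannian N ∧ Nonempty (S n ≃ᵢ N)) ∧
    Dense (⋃ n, S n)

/-! ### Continuum products -/

/-- The continuum product `L²(Y, μ, X)`: almost everywhere classes of (strongly) measurable maps `ξ`
from `Y` to `X` such that `d(ξ(y), x₀)²` is integrable for some point `x₀` of `X`; as `μ` is
finite, the choice of `x₀` is irrelevant. -/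
def ContinuumProduct {Y : Type*} [MeasurableSpace Y] (μ : Measure Y) (X : Type*) [MetricSpace X] :
    Type _ :=
  {ξ : Y →ₘ[μ] X // ∃ x₀ : X, Integrable (fun y => dist (ξ y) x₀ ^ 2) μ}

namespace ContinuumProduct

variable {Y : Type*} [MeasurableSpace Y] {μ : Measure Y} {X : Type*} [MetricSpace X]

lemma aestronglyMeasurable_dist (ξ η : Y →ₘ[μ] X) :
    AEStronglyMeasurable (fun y => dist (ξ y) (η y)) μ :=
  ξ.aestronglyMeasurable.dist η.aestronglyMeasurable

lemma memLp_dist [IsFiniteMeasure μ] (ξ η : ContinuumProduct μ X) :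
    MemLp (fun y => dist (ξ.1 y) (η.1 y)) 2 μ := by
  obtain ⟨⟨ξ, x, hx⟩, ⟨η, z, hz⟩⟩ := ξ, η
  have h1 : MemLp (fun y => dist (ξ y) x) 2 μ :=
    (memLp_two_iff_integrable_sq
      (ξ.aestronglyMeasurable.dist aestronglyMeasurable_const)).2 hx
  have h2 : MemLp (fun y => dist (η y) z) 2 μ :=
    (memLp_two_iff_integrable_sq
      (η.aestronglyMeasurable.dist aestronglyMeasurable_const)).2 hz
  have h3 : MemLp (fun _ : Y => dist x z) 2 μ := memLp_const _
  refine ((h1.add h3).add h2).mono (aestronglyMeasurable_dist ξ η) (Eventually.of_forall fun y => ?_)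
  have t1 := dist_triangle4 (ξ y) x z (η y)
  rw [dist_comm z] at t1
  simp only [Pi.add_apply, Real.norm_eq_abs]
  rw [abs_of_nonneg dist_nonneg, abs_of_nonneg (by positivity)]
  exact t1

lemma integrable_dist_sq [IsFiniteMeasure μ] (ξ η : ContinuumProduct μ X) :
    Integrable (fun y => dist (ξ.1 y) (η.1 y) ^ 2) μ :=
  (memLp_dist ξ η).integrable_sq

/-- The distance `(∫ d(ξ(y), η(y))² dμ(y))^(1/2)`. -/
def l2Dist (ξ η : ContinuumProduct μ X) : ℝ :=
  √(∫ y, dist (ξ.1 y) (η.1 y) ^ 2 ∂μ)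

lemma l2Dist_eq [IsFiniteMeasure μ] (ξ η : ContinuumProduct μ X) :
    l2Dist ξ η = (eLpNorm (fun y => dist (ξ.1 y) (η.1 y)) 2 μ).toReal := by
  rw [(memLp_dist ξ η).eLpNorm_eq_integral_rpow_norm two_ne_zero ENNReal.ofNat_ne_top,
    ENNReal.toReal_ofReal (by positivity), l2Dist, Real.sqrt_eq_rpow]
  simp

instance [IsFiniteMeasure μ] : MetricSpace (ContinuumProduct μ X) where
  dist := l2Dist
  dist_self ξ := by simp [l2Dist]
  dist_comm ξ η := by simp [l2Dist, dist_comm]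
  dist_triangle ξ η ζ := by
    rw [l2Dist_eq, l2Dist_eq, l2Dist_eq, ← ENNReal.toReal_add (memLp_dist ξ η).2.ne
      (memLp_dist η ζ).2.ne]
    refine ENNReal.toReal_mono
      (ENNReal.add_ne_top.2 ⟨(memLp_dist ξ η).2.ne, (memLp_dist η ζ).2.ne⟩) ?_
    refine le_trans (eLpNorm_mono_real (g := (fun y => dist (ξ.1 y) (η.1 y))
      + fun y => dist (η.1 y) (ζ.1 y)) fun y => ?_)
      (eLpNorm_add_le (memLp_dist ξ η).1 (memLp_dist η ζ).1 (by norm_num))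
    rw [Real.norm_eq_abs, abs_of_nonneg dist_nonneg]
    exact dist_triangle _ _ _
  eq_of_dist_eq_zero {ξ η} h := by
    have h0 : ∫ y, dist (ξ.1 y) (η.1 y) ^ 2 ∂μ = 0 :=
      (Real.sqrt_eq_zero (integral_nonneg fun y => by positivity)).1 h
    have h1 := (integral_eq_zero_iff_of_nonneg (fun y => by positivity)
      (integrable_dist_sq ξ η)).1 h0
    refine Subtype.ext (AEEqFun.ext ?_)
    filter_upwards [h1] with y hy
    exact dist_eq_zero.1 (pow_eq_zero_iff two_ne_zero |>.1 hy)

lemma dist_def [IsFiniteMeasure μ] (ξ η : ContinuumProduct μ X) :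
    dist ξ η = √(∫ y, dist (ξ.1 y) (η.1 y) ^ 2 ∂μ) := rfl

end ContinuumProduct

end HilbertHadamard

end

/-!
Let `X` be a Hilbert--Hadamard space. Both halves of the argument rest on the fact that the squared
distance of `L²(Y, μ, X)` is an integral of squared distances of `X`.

**The continuum product is Hilbert--Hadamard.** A geodesic space is CAT(0) if and only if its
geodesics satisfy the CN inequality
`d(p, m(t))² ≤ (1 - t) d(p, x)² + t d(p, y)² - t (1 - t) d(x, y)²` of Bruhat and Tits
(`IsCAT0.cn`, `IsCNBicombing.isCAT0`). As this is linear in squared distances, the pointwise geodesics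
of `L²(Y, μ, X)` inherit it. The tangent cones are treated in the same way: by the CN inequality,
`(d(p, m(s))² + d(p, m'(s))² - d(m(s), m'(s))²) / (2 s²)` increases to a limit as `s → 0`, for
geodesics `m`, `m'` from `p` to `x` and to `y`. This limit `initialKernel` is the inner product of
the initial velocities in the tangent cone, and the tangent cone at `p` embeds into a Hilbert space
if and only if the kernel is positive semidefinite: the embedding into the reproducing kernel Hilbert
space is constructed for a cone over directions, and positivity passes to the completion
(`isHilbertHadamard_iff`). By dominated convergence the kernel of `L²(Y, μ, X)` is the integral of the
kernels of `X` (`ContinuumProduct.initialKernel_eq_integral`), hence positive semidefinite.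
For completeness and separability, a Kuratowski embedding of `X` into a Banach space `E` identifies
`L²(Y, μ, X)` with a closed subset of the Bochner space `L²(Y, μ, E)`.

**Admissibility.** Let `S n` be an exhaustion of `X` and `A i` a countable measure-dense family in
`Y`. The step maps with values in `S n` that are constant on the partition generated by
`A 0, …, A (n - 1)` form an increasing sequence of subsets. By
`ContinuumProduct.exists_parametrization_stepMaps` each of them is a finite power of `S n`
with the metric `(∑ wⱼ d²)^(1/2)`, where `wⱼ > 0` are the measures of the sets of the partition that
are not null. So it is closed and geodesic. It is also a Riemannian manifold, since the Riemannian
distance of a product metric `c g + h` is `(c d² + d'²)^(1/2)`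
(`sqrt_le_riemannianEDist_prod`, `riemannianEDist_prod_le_sqrt`, `exists_riemannian_pi`). The union is
dense: its closure contains the constants and is stable under gluing along measurable sets, because
this holds for the sets `A i`; so it contains all simple maps, and these are dense
(`ContinuumProduct.dense_iUnion_stepMaps`).
-/

noncomputable section

universe u v

namespace HilbertHadamard

/-! ### CAT(0) spaces as spaces with a bicombing satisfying the CN inequality -/

section Bicombing

variable {X : Type*} [MetricSpace X]

/-- `c`, restricted to `[0, 1]`, is a geodesic from `x` to `y` parametrized proportionally to arc
length. -/
structure IsLinearGeodesic (c : ℝ → X) (x y : X) : Prop where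
  zero : c 0 = x
  one : c 1 = y
  dist_eq : ∀ s ∈ Icc (0 : ℝ) 1, ∀ t ∈ Icc (0 : ℝ) 1, dist (c s) (c t) = |s - t| * dist x y

lemma IsGeodesicSegment.isLinearGeodesic {γ : ℝ → X} {x y : X} (h : IsGeodesicSegment γ x y) :
    IsLinearGeodesic (fun t => γ (t * dist x y)) x y where
  zero := by simpa using h.source
  one := by simpa using h.target
  dist_eq s hs t ht := by
    have hd := dist_nonneg (x := x) (y := y)
    rw [h.dist_eq _ ⟨mul_nonneg hs.1 hd, mul_le_of_le_one_left hd hs.2⟩ _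
      ⟨mul_nonneg ht.1 hd, mul_le_of_le_one_left hd ht.2⟩, ← sub_mul, abs_mul, abs_of_nonneg hd]

lemma IsLinearGeodesic.isGeodesicSegment {c : ℝ → X} {x y : X} (h : IsLinearGeodesic c x y) :
    IsGeodesicSegment (fun t => c (t / dist x y)) x y := by
  rcases eq_or_ne x y with rfl | hxy
  · refine ⟨by simpa using h.zero, by simpa using h.zero, fun s hs t ht => ?_⟩
    rw [dist_self, Icc_self, mem_singleton_iff] at hs ht
    simp [hs, ht]
  · have hd := dist_pos.2 hxy
    refine ⟨by simpa using h.zero, by simpa [hd.ne'] using h.one, fun s hs t ht => ?_⟩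
    rw [h.dist_eq _ ⟨div_nonneg hs.1 hd.le, div_le_one_of_le₀ hs.2 hd.le⟩ _
      ⟨div_nonneg ht.1 hd.le, div_le_one_of_le₀ ht.2 hd.le⟩, ← sub_div, abs_div, abs_of_pos hd,
      div_mul_cancel₀ _ hd.ne']

lemma isGeodesicSpace_iff : IsGeodesicSpace X ↔ ∀ x y : X, ∃ c, IsLinearGeodesic c x y :=
  ⟨fun h x y => let ⟨_, hγ⟩ := h x y; ⟨_, hγ.isLinearGeodesic⟩,
    fun h x y => let ⟨_, hc⟩ := h x y; ⟨_, hc.isGeodesicSegment⟩⟩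

lemma IsLinearGeodesic.dist_left {c : ℝ → X} {x y : X} (h : IsLinearGeodesic c x y) {t : ℝ}
    (ht : t ∈ Icc (0 : ℝ) 1) : dist x (c t) = t * dist x y := by
  have := h.dist_eq 0 ⟨le_rfl, zero_le_one⟩ t ht
  rwa [h.zero, zero_sub, abs_neg, abs_of_nonneg ht.1] at this

lemma IsLinearGeodesic.dist_right {c : ℝ → X} {x y : X} (h : IsLinearGeodesic c x y) {t : ℝ}
    (ht : t ∈ Icc (0 : ℝ) 1) : dist y (c t) = (1 - t) * dist x y := by
  have := h.dist_eq 1 ⟨zero_le_one, le_rfl⟩ t ht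
  rwa [h.one, abs_of_nonneg (sub_nonneg.2 ht.2)] at this

lemma IsLinearGeodesic.liesOnGeodesic {c : ℝ → X} {x y : X} (h : IsLinearGeodesic c x y) {t : ℝ}
    (ht : t ∈ Icc (0 : ℝ) 1) : LiesOnGeodesic x y (c t) := by
  refine ⟨_, h.isGeodesicSegment, t * dist x y,
    ⟨mul_nonneg ht.1 dist_nonneg, mul_le_of_le_one_left dist_nonneg ht.2⟩, ?_⟩
  rcases eq_or_ne x y with rfl | hxy
  · have h1 := h.dist_left ht
    rw [dist_self, mul_zero, dist_eq_zero] at h1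
    simpa [h.zero] using h1
  · simp [(dist_pos.2 hxy).ne']

lemma LiesOnGeodesic.exists_isLinearGeodesic {x y z : X} (h : LiesOnGeodesic x y z) :
    ∃ c, IsLinearGeodesic c x y ∧ ∃ t ∈ Icc (0 : ℝ) 1, c t = z := by
  obtain ⟨γ, hγ, t, ht, rfl⟩ := h
  refine ⟨_, hγ.isLinearGeodesic, t / dist x y,
    ⟨div_nonneg ht.1 dist_nonneg, div_le_one_of_le₀ ht.2 dist_nonneg⟩, ?_⟩
  rcases eq_or_ne x y with rfl | hxy
  · rw [dist_self, Icc_self, mem_singleton_iff] at ht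
    simp [ht]
  · rw [div_mul_cancel₀ _ (dist_pos.2 hxy).ne']

/-- A choice of linear geodesics `m x y` between any two points for which all points satisfy the
(parametrized) inequality of Bruhat and Tits. -/
structure IsCNBicombing (m : X → X → ℝ → X) : Prop where
  lin : ∀ x y, IsLinearGeodesic (m x y) x y
  cn : ∀ p x y, ∀ t ∈ Icc (0 : ℝ) 1, dist p (m x y t) ^ 2 ≤
    (1 - t) * dist p x ^ 2 + t * dist p y ^ 2 - t * (1 - t) * dist x y ^ 2

/-- Stewart's theorem in an inner product space. -/
lemma norm_sub_lineMap_sq {V : Type*} [NormedAddCommGroup V] [InnerProductSpace ℝ V]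
    (p x y : V) (t : ℝ) : dist p (AffineMap.lineMap x y t) ^ 2 =
      (1 - t) * dist p x ^ 2 + t * dist p y ^ 2 - t * (1 - t) * dist x y ^ 2 := by
  have e1 : p - AffineMap.lineMap x y t = (1 - t) • (p - x) + t • (p - y) := by
    rw [AffineMap.lineMap_apply_module]; module
  have e2 : x - y = (p - y) - (p - x) := by abel
  rw [dist_eq_norm, dist_eq_norm, dist_eq_norm, dist_eq_norm, e1, e2, norm_add_sq_real,
    norm_sub_sq_real (p - y), norm_smul, norm_smul, inner_smul_left, inner_smul_right,
    mul_pow, mul_pow, Real.norm_eq_abs, Real.norm_eq_abs, sq_abs, sq_abs,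
    real_inner_comm (p - x) (p - y)]
  simp only [conj_trivial]
  ring

/-- Three nonnegative numbers satisfying the triangle inequalities are the side lengths of a
triangle in the plane. -/
lemma exists_comparison_triangle {a b c : ℝ} (ha : 0 ≤ a) (hb : 0 ≤ b) (hc : 0 ≤ c)
    (hab : a ≤ b + c) (hbc : b ≤ a + c) (hca : c ≤ a + b) :
    ∃ p q r : EuclideanSpace ℝ (Fin 2), dist p q = a ∧ dist p r = b ∧ dist q r = c := by
  rcases ha.eq_or_lt with rfl | ha
  · obtain rfl : b = c := by linarith
    exact ⟨0, 0, !₂[b, 0], by simp, by simp [EuclideanSpace.dist_eq, Real.sqrt_sq hb],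
      by simp [EuclideanSpace.dist_eq, Real.sqrt_sq hb]⟩
  · obtain ⟨u, hu⟩ : ∃ u, u = (a ^ 2 + b ^ 2 - c ^ 2) / (2 * a) := ⟨_, rfl⟩
    have hua : 2 * a * u = a ^ 2 + b ^ 2 - c ^ 2 := by rw [hu]; field_simp
    have hub : 0 ≤ b ^ 2 - u ^ 2 := by
      have h : 0 ≤ (2 * a) ^ 2 * (b ^ 2 - u ^ 2) := by
        have : (2 * a) ^ 2 * (b ^ 2 - u ^ 2) = ((a + b) ^ 2 - c ^ 2) * (c ^ 2 - (a - b) ^ 2) := by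
          rw [mul_sub, ← mul_pow (2 * a) u, hua]; ring
        rw [this]
        refine mul_nonneg ?_ ?_
        · nlinarith
        · nlinarith [mul_nonneg (sub_nonneg.2 hab) (sub_nonneg.2 hbc)]
      exact nonneg_of_mul_nonneg_right h (by positivity)
    refine ⟨0, !₂[a, 0], !₂[u, √(b ^ 2 - u ^ 2)], ?_, ?_, ?_⟩
    · simp [EuclideanSpace.dist_eq, Real.sqrt_sq ha.le]
    · simp [EuclideanSpace.dist_eq, Real.sq_sqrt hub, Real.sqrt_sq hb]
    · rw [EuclideanSpace.dist_eq, Real.sqrt_eq_iff_mul_self_eq (by positivity) hc]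
      simp [Real.dist_eq, Real.sq_sqrt hub]
      linarith

/-- Thinness of triangles, for a vertex and a point on the opposite side, is the CN inequality. -/
lemma IsCAT0.cn (hX : IsCAT0 X) {c : ℝ → X} {x y : X} (hc : IsLinearGeodesic c x y) (p : X)
    {t : ℝ} (ht : t ∈ Icc (0 : ℝ) 1) : dist p (c t) ^ 2 ≤
      (1 - t) * dist p x ^ 2 + t * dist p y ^ 2 - t * (1 - t) * dist x y ^ 2 := by
  obtain ⟨x', y', p', h1, h2, h3⟩ := exists_comparison_triangle (a := dist x y) (b := dist x p)
    (c := dist y p) dist_nonneg dist_nonneg dist_nonneg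
    (dist_comm y p ▸ dist_triangle x p y) (dist_triangle x y p)
    (by rw [dist_comm x y]; exact dist_triangle y x p)
  obtain ⟨d, hd⟩ := isGeodesicSpace_iff.1 hX.geodesic x p
  have hp : LiesOnGeodesic x p p := by
    simpa [hd.one] using hd.liesOnGeodesic (t := 1) ⟨zero_le_one, le_rfl⟩
  have hz' : dist x' (AffineMap.lineMap x' y' t) = dist x (c t) := by
    rw [hc.dist_left ht, dist_left_lineMap, Real.norm_eq_abs, abs_of_nonneg ht.1, h1]
  have key := hX.thin x y p (c t) p (hc.liesOnGeodesic ht) hp x' y' p'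
    (AffineMap.lineMap x' y' t) p' h1 h2 h3
    (by rw [segment_eq_image_lineMap]; exact mem_image_of_mem _ ht) hz'
    (right_mem_segment ℝ x' p') h2
  rw [dist_comm p (c t), dist_comm p x, dist_comm p y, ← h1, ← h2, ← h3, dist_comm x' p',
    dist_comm y' p', ← norm_sub_lineMap_sq p' x' y' t, dist_comm p']
  gcongr

lemma IsCAT0.exists_isCNBicombing (hX : IsCAT0 X) : ∃ m : X → X → ℝ → X, IsCNBicombing m := by
  choose m hm using isGeodesicSpace_iff.1 hX.geodesic
  exact ⟨m, hm, fun p x y t ht => hX.cn (hm x y) p ht⟩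

namespace IsCNBicombing

variable {m : X → X → ℝ → X} (hm : IsCNBicombing m)
include hm

/-- Geodesics are unique, and they are determined by the distances to their end points. -/
lemma eq_of_dist {x y z : X} {t : ℝ} (ht : t ∈ Icc (0 : ℝ) 1) (h1 : dist z x = t * dist x y)
    (h2 : dist z y = (1 - t) * dist x y) : z = m x y t := by
  have h := hm.cn z x y t ht
  rw [h1, h2] at h
  have : dist z (m x y t) ^ 2 ≤ 0 := h.trans_eq (by ring)
  exact dist_eq_zero.1 (pow_eq_zero_iff two_ne_zero |>.1 (le_antisymm this (sq_nonneg _)))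

lemma eq_of_isLinearGeodesic {c : ℝ → X} {x y : X} (hc : IsLinearGeodesic c x y) {t : ℝ}
    (ht : t ∈ Icc (0 : ℝ) 1) : c t = m x y t :=
  hm.eq_of_dist ht (by rw [dist_comm, hc.dist_left ht]) (by rw [dist_comm, hc.dist_right ht])

/-- In the plane the two sides of the estimate obtained by applying the CN inequality twice agree,
so the CN inequality implies thinness of triangles. -/
theorem isCAT0 : IsCAT0 X where
  geodesic := isGeodesicSpace_iff.2 fun x y => ⟨_, hm.lin x y⟩
  thin p q r x y hx hy p' q' r' x' y' h1 h2 h3 hx' hpx hy' hpy := by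
    obtain ⟨c, hc, s, hs, rfl⟩ := hx.exists_isLinearGeodesic
    obtain ⟨d, hd, t, ht, rfl⟩ := hy.exists_isLinearGeodesic
    rw [segment_eq_image_lineMap] at hx' hy'
    have aux : ∀ (P Q : EuclideanSpace ℝ (Fin 2)) (z : EuclideanSpace ℝ (Fin 2)) (u : ℝ),
        u ∈ Icc (0 : ℝ) 1 → z ∈ AffineMap.lineMap P Q '' Icc (0 : ℝ) 1 →
        dist P z = u * dist P Q → z = AffineMap.lineMap P Q u := by
      rintro P Q _ u hu ⟨v, hv, rfl⟩ h
      rw [dist_left_lineMap, Real.norm_eq_abs, abs_of_nonneg hv.1] at h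
      rcases eq_or_ne P Q with rfl | hPQ
      · simp
      · rw [mul_right_cancel₀ (dist_pos.2 hPQ).ne' h]
    obtain rfl := aux p' q' x' s hs hx' (by rw [hpx, hc.dist_left hs, h1])
    obtain rfl := aux p' r' y' t ht hy' (by rw [hpy, hd.dist_left ht, h2])
    rw [hm.eq_of_isLinearGeodesic hc hs, hm.eq_of_isLinearGeodesic hd ht]
    have k1 := hm.cn (m p q s) p r t ht
    have k2 := hm.cn r p q s hs
    have k3 := (hm.lin p q).dist_left hs
    have l1 := norm_sub_lineMap_sq (AffineMap.lineMap p' q' s) p' r' t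
    have l2 := norm_sub_lineMap_sq r' p' q' s
    have l3 : dist p' (AffineMap.lineMap p' q' s) = s * dist p' q' := by
      rw [dist_left_lineMap, Real.norm_eq_abs, abs_of_nonneg hs.1]
    rw [dist_comm _ p, k3, dist_comm _ r] at k1
    rw [dist_comm _ p', l3, dist_comm _ r', l2, h1, h2, dist_comm r' p', dist_comm r' q', h2,
      h3] at l1
    rw [dist_comm r p, dist_comm r q] at k2
    refine le_of_sq_le_sq ?_ dist_nonneg
    rw [l1]
    have := mul_le_mul_of_nonneg_left k2 ht.1
    linarith

lemma dist_le_left (x x' y : X) {t : ℝ} (ht : t ∈ Icc (0 : ℝ) 1) :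
    dist (m x y t) (m x' y t) ≤ (1 - t) * dist x x' := by
  have h1 := hm.cn (m x y t) x' y t ht
  have h2 := hm.cn x' x y t ht
  have h3 := (hm.lin x y).dist_right ht
  rw [dist_comm _ x', dist_comm _ y, h3] at h1
  have h4 := mul_le_mul_of_nonneg_left h2 (sub_nonneg.2 ht.2)
  refine le_of_sq_le_sq ?_ (mul_nonneg (sub_nonneg.2 ht.2) dist_nonneg)
  rw [dist_comm x x']
  nlinarith

lemma dist_le_right (x y y' : X) {t : ℝ} (ht : t ∈ Icc (0 : ℝ) 1) :
    dist (m x y t) (m x y' t) ≤ t * dist y y' := by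
  have h1 := hm.cn (m x y t) x y' t ht
  have h2 := hm.cn y' x y t ht
  have h3 := (hm.lin x y).dist_left ht
  rw [dist_comm _ x, dist_comm _ y', h3, dist_comm x y'] at h1
  rw [dist_comm y' y] at h2
  have h4 := mul_le_mul_of_nonneg_left h2 ht.1
  refine le_of_sq_le_sq ?_ (mul_nonneg ht.1 dist_nonneg)
  nlinarith

lemma continuous {t : ℝ} (ht : t ∈ Icc (0 : ℝ) 1) :
    Continuous fun p : X × X => m p.1 p.2 t := by
  refine LipschitzWith.continuous (K := 1) (LipschitzWith.of_dist_le_mul fun p q => ?_)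
  have h1 := hm.dist_le_left p.1 q.1 p.2 ht
  have h2 := hm.dist_le_right q.1 p.2 q.2 ht
  have h3 := dist_triangle (m p.1 p.2 t) (m q.1 p.2 t) (m q.1 q.2 t)
  have h4 : dist p.1 q.1 ≤ dist p q := le_max_left _ _
  have h5 : dist p.2 q.2 ≤ dist p q := le_max_right _ _
  have := mul_le_mul_of_nonneg_left h4 (sub_nonneg.2 ht.2)
  have := mul_le_mul_of_nonneg_left h5 ht.1
  simp only [NNReal.coe_one, one_mul]
  linarith

lemma apply_apply (p x : X) {s t : ℝ} (hs : s ∈ Icc (0 : ℝ) 1) (ht : t ∈ Icc (0 : ℝ) 1) :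
    m p (m p x s) t = m p x (t * s) := by
  have hts : t * s ∈ Icc (0 : ℝ) 1 := ⟨mul_nonneg ht.1 hs.1, mul_le_one₀ ht.2 hs.1 hs.2⟩
  symm
  have h0 := (hm.lin p x).dist_left hs
  refine hm.eq_of_dist ht ?_ ?_
  · rw [dist_comm, (hm.lin p x).dist_left hts, h0, mul_assoc]
  · rw [(hm.lin p x).dist_eq _ hts _ hs, h0, ← mul_assoc, abs_sub_comm, abs_of_nonneg]
    · ring
    · nlinarith [hs.1, ht.2]

end IsCNBicombing

end Bicombing

/-! ### The inner product of initial velocities -/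

section InitialKernel

variable {X : Type*} [MetricSpace X]

/-- The product `d(p, x) d(p, y) cos ∠~` for the comparison angle `∠~` at `p` of `x, p, y`
(the Gromov product of the squared distances). -/
def bracket (p x y : X) : ℝ := (dist p x ^ 2 + dist p y ^ 2 - dist x y ^ 2) / 2

lemma bracket_comm (p x y : X) : bracket p x y = bracket p y x := by
  unfold bracket
  rw [dist_comm x y]
  ring

lemma abs_bracket_le (p x y : X) : |bracket p x y| ≤ dist p x * dist p y := by
  have t1 := dist_triangle p x y
  have t2 := dist_triangle p y x
  have t3 := dist_triangle x p y
  rw [dist_comm y x] at t2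
  rw [dist_comm x p] at t3
  have : |dist p x - dist p y| ≤ dist x y := abs_le.2 ⟨by linarith, by linarith⟩
  have h1 := sq_le_sq' (by linarith [abs_nonneg (dist p x - dist p y)]) this
  rw [sq_abs] at h1
  have h2 := pow_le_pow_left₀ dist_nonneg t3 2
  unfold bracket
  rw [abs_le]
  constructor <;> nlinarith

/-- The products of the comparison angles for the points at times `s` and `t` on the geodesics from
`p` to `x` and to `y`, rescaled to the lengths of these geodesics. -/
def scaledBracket (m : X → X → ℝ → X) (p x y : X) (s t : ℝ) : ℝ :=
  bracket p (m p x s) (m p y t) / (s * t)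

/-- The product `d(p, x) d(p, y) cos ∠` for the angle `∠` at `p` between the geodesics to `x` and
`y`. In other words, the inner product of the initial velocities of these geodesics. -/
def initialKernel (m : X → X → ℝ → X) (p x y : X) : ℝ :=
  limUnder (𝓝[>] (0 : ℝ) ×ˢ 𝓝[>] (0 : ℝ)) fun st => scaledBracket m p x y st.1 st.2

/-- A real kernel all of whose finite quadratic forms are nonnegative. -/
def IsPSDKernel {S : Type*} (K : S → S → ℝ) : Prop :=
  ∀ (n : ℕ) (x : Fin n → S) (c : Fin n → ℝ), 0 ≤ ∑ i, ∑ j, c i * c j * K (x i) (x j)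

lemma scaledBracket_comm (m : X → X → ℝ → X) (p x y : X) (s t : ℝ) :
    scaledBracket m p x y s t = scaledBracket m p y x t s := by
  unfold scaledBracket
  rw [bracket_comm, mul_comm s t]

lemma Ioc_mem_nhdsGT_zero : Ioc (0 : ℝ) 1 ∈ 𝓝[>] (0 : ℝ) := Ioc_mem_nhdsGT one_pos

namespace IsCNBicombing

variable {m : X → X → ℝ → X} (hm : IsCNBicombing m)
include hm

lemma abs_scaledBracket_le (p x y : X) {s t : ℝ} (hs : s ∈ Ioc (0 : ℝ) 1)
    (ht : t ∈ Ioc (0 : ℝ) 1) : |scaledBracket m p x y s t| ≤ dist p x * dist p y := by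
  have h := abs_bracket_le p (m p x s) (m p y t)
  rw [(hm.lin p x).dist_left ⟨hs.1.le, hs.2⟩, (hm.lin p y).dist_left ⟨ht.1.le, ht.2⟩] at h
  unfold scaledBracket
  have hst : 0 < s * t := mul_pos hs.1 ht.1
  rw [abs_div, abs_of_pos hst, div_le_iff₀ hst]
  linarith

/-- The CN inequality, in terms of `bracket`. -/
lemma mul_bracket_le (p x y : X) {t : ℝ} (ht : t ∈ Icc (0 : ℝ) 1) :
    t * bracket p x y ≤ bracket p (m p x t) y := by
  have h := hm.cn y p x t ht
  unfold bracket
  rw [(hm.lin p x).dist_left ht, dist_comm (m p x t), dist_comm x y]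
  rw [dist_comm y p] at h
  linarith

lemma scaledBracket_anti_left (p x y : X) {s s' t : ℝ} (hs' : 0 < s') (hss : s' ≤ s)
    (hs : s ≤ 1) (ht : 0 < t) : scaledBracket m p x y s t ≤ scaledBracket m p x y s' t := by
  have hs0 := hs'.trans_le hss
  have hr : s' / s ∈ Icc (0 : ℝ) 1 := ⟨by positivity, div_le_one_of_le₀ hss hs0.le⟩
  have h := hm.mul_bracket_le p (m p x s) (m p y t) hr
  rw [hm.apply_apply p x ⟨hs0.le, hs⟩ hr, div_mul_cancel₀ _ hs0.ne'] at h
  unfold scaledBracket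
  rw [div_le_div_iff₀ (by positivity) (by positivity)]
  calc bracket p (m p x s) (m p y t) * (s' * t)
      = s' / s * bracket p (m p x s) (m p y t) * (s * t) := by field_simp
    _ ≤ _ := by gcongr

lemma scaledBracket_anti (p x y : X) {s s' t t' : ℝ} (hs' : 0 < s') (hss : s' ≤ s)
    (hs : s ≤ 1) (ht' : 0 < t') (htt : t' ≤ t) (ht : t ≤ 1) :
    scaledBracket m p x y s t ≤ scaledBracket m p x y s' t' := by
  refine (hm.scaledBracket_anti_left p x y hs' hss hs (ht'.trans_le htt)).trans ?_
  rw [scaledBracket_comm, scaledBracket_comm m p x]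
  exact hm.scaledBracket_anti_left p y x ht' htt ht hs'

/-- Comparison angles decrease towards the vertex in a CAT(0) space, so their limit exists. -/
lemma tendsto_initialKernel (p x y : X) :
    Tendsto (fun st : ℝ × ℝ => scaledBracket m p x y st.1 st.2) (𝓝[>] (0 : ℝ) ×ˢ 𝓝[>] (0 : ℝ))
      (𝓝 (initialKernel m p x y)) := by
  apply tendsto_nhds_limUnder
  obtain ⟨A, hA⟩ : ∃ A, A = (fun st : ℝ × ℝ => scaledBracket m p x y st.1 st.2) ''
    (Ioc (0 : ℝ) 1 ×ˢ Ioc (0 : ℝ) 1) := ⟨_, rfl⟩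
  have hne : A.Nonempty := by
    rw [hA]
    exact Nonempty.image _ ⟨(1, 1), ⟨one_pos, le_rfl⟩, ⟨one_pos, le_rfl⟩⟩
  have hbdd : BddAbove A := by
    refine ⟨dist p x * dist p y, ?_⟩
    rw [hA]
    rintro _ ⟨st, ⟨hs, ht⟩, rfl⟩
    exact (le_abs_self _).trans (hm.abs_scaledBracket_le p x y hs ht)
  refine ⟨sSup A, tendsto_order.2 ⟨fun a ha => ?_, fun a ha => ?_⟩⟩
  · obtain ⟨b, hb, hab⟩ := exists_lt_of_lt_csSup hne ha
    rw [hA] at hb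
    obtain ⟨⟨s, t⟩, ⟨hs, ht⟩, rfl⟩ := hb
    filter_upwards [prod_mem_prod (Ioc_mem_nhdsGT hs.1) (Ioc_mem_nhdsGT ht.1)] with q hq
    exact hab.trans_le (hm.scaledBracket_anti p x y hq.1.1 hq.1.2 hs.2 hq.2.1 hq.2.2 ht.2)
  · filter_upwards [prod_mem_prod Ioc_mem_nhdsGT_zero Ioc_mem_nhdsGT_zero] with q hq
    refine (le_csSup hbdd ?_).trans_lt ha
    rw [hA]
    exact mem_image_of_mem _ hq

lemma tendsto_initialKernel_diag (p x y : X) :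
    Tendsto (fun s : ℝ => scaledBracket m p x y s s) (𝓝[>] (0 : ℝ))
      (𝓝 (initialKernel m p x y)) := by
  have h := (hm.tendsto_initialKernel p x y).comp (tendsto_diag (f := 𝓝[>] (0 : ℝ)))
  simpa only [Function.comp_def, Function.diag] using h

lemma abs_initialKernel_le (p x y : X) : |initialKernel m p x y| ≤ dist p x * dist p y := by
  refine le_of_tendsto (hm.tendsto_initialKernel_diag p x y).abs ?_
  filter_upwards [Ioc_mem_nhdsGT_zero] with s hs
  exact hm.abs_scaledBracket_le p x y hs hs

/-- A nontrivial geodesic segment is part of the bicombing. -/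
lemma toFun_eq {p : X} (α : GeodesicFrom p) {s : ℝ} (hs : s ∈ Icc 0 α.length) :
    α.toFun s = m p (α.toFun α.length) (s / α.length) := by
  have hl := α.length_pos
  have h0 : dist p (α.toFun α.length) = α.length := by
    rw [dist_comm]; exact α.dist_base ⟨hl, le_rfl⟩
  refine hm.eq_of_dist ⟨div_nonneg hs.1 hl.le, div_le_one_of_le₀ hs.2 hl.le⟩ ?_ ?_
  · have h := α.dist_eq s hs 0 ⟨le_rfl, hl.le⟩
    rw [α.map_zero, sub_zero, abs_of_nonneg hs.1] at h
    rw [h0, div_mul_cancel₀ _ hl.ne', h]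
  · rw [h0, sub_mul, div_mul_cancel₀ _ hl.ne', one_mul, α.dist_eq s hs _ ⟨hl.le, le_rfl⟩,
      abs_sub_comm, abs_of_nonneg (sub_nonneg.2 hs.2)]

/-- The kernel at the end points of two segments determines their angle; neither segment has to be
written as part of the bicombing, since geodesics are unique. -/
lemma cos_angle {p : X} (α β : GeodesicFrom p) :
    α.length * β.length * Real.cos (α.angle β) =
      initialKernel m p (α.toFun α.length) (β.toFun β.length) := by
  have ha := α.length_pos
  have hb := β.length_pos
  have hda : dist p (α.toFun α.length) = α.length := by
    rw [dist_comm]; exact α.dist_base ⟨ha, le_rfl⟩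
  have hdb : dist p (β.toFun β.length) = β.length := by
    rw [dist_comm]; exact β.dist_base ⟨hb, le_rfl⟩
  obtain ⟨L, hL⟩ : ∃ L, L = initialKernel m p (α.toFun α.length) (β.toFun β.length) := ⟨_, rfl⟩
  have habs := hm.abs_initialKernel_le p (α.toFun α.length) (β.toFun β.length)
  rw [← hL, hda, hdb, abs_le] at habs
  have scale : ∀ {a : ℝ}, 0 < a → Tendsto (fun s : ℝ => s / a) (𝓝[>] 0) (𝓝[>] 0) := by
    intro a ha
    refine tendsto_nhdsWithin_iff.2 ⟨?_, ?_⟩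
    · have : Tendsto (fun s : ℝ => s / a) (𝓝 0) (𝓝 (0 / a)) := tendsto_id.div_const a
      rw [zero_div] at this
      exact this.mono_left nhdsWithin_le_nhds
    · filter_upwards [self_mem_nhdsWithin] with s hs using div_pos hs ha
  have lim := (hm.tendsto_initialKernel p (α.toFun α.length) (β.toFun β.length)).comp
    ((scale ha).prodMap (scale hb))
  rw [← hL] at lim
  have lim2 := ((Real.continuous_arccos.tendsto _).comp (lim.div_const (α.length * β.length)))
  have hangle : α.angle β = Real.arccos (L / (α.length * β.length)) := by
    refine Tendsto.limsup_eq (lim2.congr' ?_)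
    filter_upwards [prod_mem_prod (Ioc_mem_nhdsGT ha) (Ioc_mem_nhdsGT hb)] with st hst
    obtain ⟨hs, ht⟩ := hst
    have hs0 := hs.1.ne'
    have ht0 := ht.1.ne'
    simp only [Function.comp_apply, Prod.map_fst, Prod.map_snd, scaledBracket]
    rw [← hm.toFun_eq α ⟨hs.1.le, hs.2⟩, ← hm.toFun_eq β ⟨ht.1.le, ht.2⟩]
    unfold bracket comparisonAngle
    rw [dist_comm (α.toFun st.1) p, dist_comm p, α.dist_base hs, dist_comm p, β.dist_base ht]
    congr 1
    field_simp
  have hab : 0 < α.length * β.length := mul_pos ha hb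
  rw [hangle, Real.cos_arccos, mul_div_cancel₀ _ hab.ne', hL]
  · rw [le_div_iff₀ hab]; linarith
  · rw [div_le_iff₀ hab]; linarith

/-- The geodesic from `p` to another point `x`, parametrized by arc length. -/
def geodesicTo {p x : X} (h : p ≠ x) : GeodesicFrom p where
  length := dist p x
  length_pos := dist_pos.2 h
  toFun s := m p x (s / dist p x)
  map_zero := by simpa using (hm.lin p x).zero
  dist_eq s hs t ht :=
    (hm.lin p x).isGeodesicSegment.dist_eq s hs t ht

lemma geodesicTo_end {p x : X} (h : p ≠ x) :
    (hm.geodesicTo h).toFun (hm.geodesicTo h).length = x :=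
  (hm.lin p x).isGeodesicSegment.target

open Classical in
/-- The tangent vector at `p` pointing to `x`, of length `d(p, x)`: the logarithm map. -/
def log (p x : X) : TangentCone p :=
  if h : p = x then MetricCone.tip
  else MetricCone.ray ((SeparationQuotient.mk (hm.geodesicTo h) :
    SeparationQuotient (GeodesicFrom p)) : SpaceOfDirections p) (dist p x) (dist_pos.2 h)

lemma dist_tip_log (p x : X) : dist MetricCone.tip (hm.log p x) = dist p x := by
  rw [MetricCone.dist_def, MetricCone.coneDist_tip_left]
  unfold log
  split_ifs with h
  · simp [MetricCone.radius, h]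
  · rfl

omit hm in
lemma dist_directions {p : X} (α β : GeodesicFrom p) :
    dist ((SeparationQuotient.mk α : SeparationQuotient (GeodesicFrom p)) : SpaceOfDirections p)
      ((SeparationQuotient.mk β : SeparationQuotient (GeodesicFrom p)) : SpaceOfDirections p) =
      α.angle β := by
  rw [UniformSpace.Completion.dist_eq]
  rfl

lemma dist_log_log (p x y : X) : dist (hm.log p x) (hm.log p y) ^ 2 =
    dist p x ^ 2 + dist p y ^ 2 - 2 * initialKernel m p x y := by
  have hz : ∀ a b : X, dist p a = 0 ∨ dist p b = 0 → initialKernel m p a b = 0 := by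
    intro a b h
    have := hm.abs_initialKernel_le p a b
    have h0 : dist p a * dist p b = 0 := by rcases h with h | h <;> simp [h]
    rw [h0] at this
    exact abs_nonpos_iff.1 this
  by_cases hx : p = x
  · have : hm.log p x = MetricCone.tip := dif_pos hx
    rw [this, dist_tip_log, hz x y (Or.inl (dist_eq_zero.2 hx)), dist_eq_zero.2 hx]
    ring
  by_cases hy : p = y
  · have : hm.log p y = MetricCone.tip := dif_pos hy
    rw [this, dist_comm, dist_tip_log, hz x y (Or.inr (dist_eq_zero.2 hy)), dist_eq_zero.2 hy]
    ring
  · rw [show hm.log p x = _ from dif_neg hx, show hm.log p y = _ from dif_neg hy,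
      MetricCone.dist_def]
    simp only [MetricCone.coneDist, MetricCone.angle, MetricCone.radius]
    have hc := hm.cos_angle (hm.geodesicTo hx) (hm.geodesicTo hy)
    rw [geodesicTo_end, geodesicTo_end] at hc
    rw [dist_directions, min_eq_left (GeodesicFrom.angle_le_pi _ _), Real.sq_sqrt, ← hc]
    · simp only [geodesicTo]; ring
    · have := Real.cos_le_one ((hm.geodesicTo hx).angle (hm.geodesicTo hy))
      have h1 : 0 ≤ dist p x * dist p y := by positivity
      nlinarith [sq_nonneg (dist p x - dist p y), mul_nonneg h1 (sub_nonneg.2 this)]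

end IsCNBicombing

/-- A kernel given by inner products is positive semidefinite. -/
lemma isPSDKernel_inner {S H : Type*} [NormedAddCommGroup H] [InnerProductSpace ℝ H] (f : S → H) :
    IsPSDKernel fun x y => inner ℝ (f x) (f y) := by
  intro n x c
  have : ∑ i, ∑ j, c i * c j * inner ℝ (f (x i)) (f (x j)) =
      inner ℝ (∑ i, c i • f (x i)) (∑ i, c i • f (x i)) := by
    simp only [sum_inner, inner_sum, inner_smul_left, inner_smul_right, conj_trivial, mul_assoc,
      Finset.mul_sum, real_inner_comm]
  rw [this]
  exact real_inner_self_nonneg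

/-- An embedding of the tangent cone into a Hilbert space represents the kernel of initial
velocities by inner products. -/
lemma IsCNBicombing.isPSDKernel_of_isometry {m : X → X → ℝ → X} (hm : IsCNBicombing m) {p : X}
    {H : Type*} [NormedAddCommGroup H] [InnerProductSpace ℝ H] {f : TangentCone p → H}
    (hf : Isometry f) : IsPSDKernel (initialKernel m p) := by
  have key : initialKernel m p = fun x y => inner ℝ (f (hm.log p x) - f MetricCone.tip)
      (f (hm.log p y) - f MetricCone.tip) := by
    ext x y
    rw [real_inner_eq_norm_mul_self_add_norm_mul_self_sub_norm_sub_mul_self_div_two,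
      sub_sub_sub_cancel_right, ← dist_eq_norm, ← dist_eq_norm, ← dist_eq_norm, hf.dist_eq,
      hf.dist_eq, hf.dist_eq, dist_comm _ MetricCone.tip, dist_comm _ MetricCone.tip,
      hm.dist_tip_log, hm.dist_tip_log, ← sq, ← sq, ← sq, hm.dist_log_log]
    ring
  rw [key]
  exact isPSDKernel_inner _

end InitialKernel

/-! ### Positive semidefinite kernels and embeddings of cones -/

/-- A symmetric positive semidefinite kernel is given by inner products in a Hilbert space, for
instance in its reproducing kernel Hilbert space. -/
lemma IsPSDKernel.exists_hilbert {S : Type u} {K : S → S → ℝ} (hK : IsPSDKernel K)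
    (hsymm : ∀ x y, K x y = K y x) :
    ∃ (H : Type u) (_ : NormedAddCommGroup H) (_ : InnerProductSpace ℝ H) (_ : CompleteSpace H)
      (f : S → H), ∀ x y, inner ℝ (f x) (f y) = K x y := by
  obtain ⟨A, hA⟩ : ∃ A : Matrix S S (ℝ →L[ℝ] ℝ),
    A = Matrix.of fun x y => K x y • ContinuousLinearMap.id ℝ ℝ := ⟨_, rfl⟩
  have hAxy : ∀ x y v, A x y v = K x y * v := by intro x y v; simp [hA]
  have hpos : A.PosSemidef := by
    have tfae := (RKHS.posSemidef_tfae (K := A)).out 0 2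
    refine tfae.2 ⟨?_, fun v => ?_⟩
    · ext x y
      have := ContinuousLinearMap.adjoint_inner_right (A y x) 1 1
      simp only [hAxy] at this
      simp only [Matrix.conjTranspose_apply, ContinuousLinearMap.star_eq_adjoint, hAxy]
      simpa [hsymm y x, mul_comm] using this
    · simp only [hAxy, RCLike.re_to_real, Finsupp.sum]
      have h := hK _ (fun i => (v.support.equivFin.symm i : S))
        (fun i => v (v.support.equivFin.symm i))
      rw [← Finset.sum_coe_sort, ← v.support.equivFin.symm.sum_comp]
      refine h.trans_eq (Finset.sum_congr rfl fun i _ => ?_)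
      rw [← Finset.sum_coe_sort v.support, ← v.support.equivFin.symm.sum_comp]
      refine Finset.sum_congr rfl fun j _ => ?_
      simp [hsymm (v.support.equivFin.symm j : S)]
      ring
  have : Fact A.PosSemidef := ⟨hpos⟩
  refine ⟨RKHS.OfKernel A, inferInstance, inferInstance, inferInstance,
    fun x => RKHS.kerFun (RKHS.OfKernel A) x 1, fun x y => ?_⟩
  rw [← RKHS.kernel_inner, RKHS.OfKernel.kernel_ofKernel, hAxy]
  simp [hsymm y x]

/-- The scalar product of two points of a cone inherits positivity from the cosine kernel of the
base, as the tip contributes nothing. -/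
lemma IsPSDKernel.cone {S : Type*} [MetricSpace S]
    (h : IsPSDKernel fun v w : S => Real.cos (min (dist v w) Real.pi)) :
    IsPSDKernel fun a b : MetricCone S => a.radius * b.radius * Real.cos (a.angle b) := by
  intro n x c
  rcases isEmpty_or_nonempty S with hS | ⟨⟨v₀⟩⟩
  · have : ∀ a : MetricCone S, a.radius = 0 := by
      rintro (_ | ⟨v, r, hr⟩)
      · rfl
      · exact isEmptyElim v
    simp [this]
  · obtain ⟨dir, hdir⟩ : ∃ dir : MetricCone S → S, ∀ v r hr, dir (.ray v r hr) = v :=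
      ⟨fun a => match a with
        | .tip => v₀
        | .ray v _ _ => v, fun _ _ _ => rfl⟩
    refine (h n (fun i => dir (x i)) (fun i => c i * (x i).radius)).trans_eq ?_
    refine Finset.sum_congr rfl fun i _ => Finset.sum_congr rfl fun j _ => ?_
    rcases x i with _ | ⟨v, r, hr⟩
    · simp [MetricCone.radius]
    rcases x j with _ | ⟨w, t, ht⟩
    · simp [MetricCone.radius]
    simp only [hdir, MetricCone.radius, MetricCone.angle]
    ring

/-- By the law of cosines a cone embeds isometrically into a Hilbert space as soon as the cosine
kernel of its base is positive semidefinite. -/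
lemma exists_isometry_cone {S : Type u} [MetricSpace S]
    (h : IsPSDKernel fun v w : S => Real.cos (min (dist v w) Real.pi)) :
    ∃ (H : Type u) (_ : NormedAddCommGroup H) (_ : InnerProductSpace ℝ H)
      (_ : CompleteSpace H) (f : MetricCone S → H), Isometry f := by
  have hangle : ∀ a b : MetricCone S, a.angle b = b.angle a := by
    intro a b; cases a <;> cases b <;> simp [MetricCone.angle, dist_comm]
  obtain ⟨H, i1, i2, i3, f, hf⟩ := h.cone.exists_hilbert fun a b => by
    rw [hangle a b]; ring
  refine ⟨H, i1, i2, i3, f, Isometry.of_dist_eq fun a b => ?_⟩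
  rw [MetricCone.dist_def, MetricCone.coneDist, dist_eq_norm, ← Real.sqrt_sq (norm_nonneg _),
    norm_sub_sq_real, ← real_inner_self_eq_norm_sq, ← real_inner_self_eq_norm_sq, hf, hf, hf]
  have h0 : ∀ c : MetricCone S, c.radius * c.radius * Real.cos (c.angle c) = c.radius ^ 2 := by
    rintro (_ | ⟨v, r, hr⟩)
    · simp [MetricCone.radius]
    · simp [MetricCone.radius, MetricCone.angle, Real.pi_pos.le, sq]
  rw [h0, h0]
  congr 1
  ring

section

variable {X : Type u} [MetricSpace X]

/-- Positivity passes from the directions of geodesics to the completion by continuity. -/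
lemma IsCNBicombing.isPSDKernel_directions {m : X → X → ℝ → X} (hm : IsCNBicombing m) {p : X}
    (h : IsPSDKernel (initialKernel m p)) :
    IsPSDKernel fun v w : SpaceOfDirections p => Real.cos (min (dist v w) Real.pi) := by
  intro n x c
  let e : GeodesicFrom p → SpaceOfDirections p := fun α =>
    ((SeparationQuotient.mk α : SeparationQuotient (GeodesicFrom p)) : SpaceOfDirections p)
  have he : DenseRange e := UniformSpace.Completion.denseRange_coe.comp
    SeparationQuotient.surjective_mk.denseRange (UniformSpace.Completion.continuous_coe _)
  have hd : DenseRange (Pi.map fun _ : Fin n => e) := DenseRange.piMap fun _ => he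
  refine hd.induction_on (p := fun x : Fin n → SpaceOfDirections p =>
    0 ≤ ∑ i, ∑ j, c i * c j * Real.cos (min (dist (x i) (x j)) Real.pi)) x
    (isClosed_le (by fun_prop) (by fun_prop)) fun α => ?_
  refine (h n (fun i => (α i).toFun (α i).length) (fun i => c i / (α i).length)).trans_eq ?_
  refine Finset.sum_congr rfl fun i _ => Finset.sum_congr rfl fun j _ => ?_
  have h1 := (α i).length_pos.ne'
  have h2 := (α j).length_pos.ne'
  simp only [Pi.map_apply, e]
  rw [IsCNBicombing.dist_directions, min_eq_left (GeodesicFrom.angle_le_pi _ _), ← hm.cos_angle]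
  field_simp

/-- Hilbert--Hadamard spaces in terms of a bicombing and its kernels of initial velocities. -/
theorem isHilbertHadamard_iff : IsHilbertHadamard X ↔ Nonempty X ∧ CompleteSpace X ∧
    ∃ m : X → X → ℝ → X, IsCNBicombing m ∧ ∀ p, IsPSDKernel (initialKernel m p) := by
  refine ⟨fun h => ⟨h.nonempty, h.complete, ?_⟩, ?_⟩
  · obtain ⟨m, hm⟩ := h.cat0.exists_isCNBicombing
    refine ⟨m, hm, fun p => ?_⟩
    obtain ⟨H, _, _, _, f, hf⟩ := h.tangentCone p
    exact hm.isPSDKernel_of_isometry hf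
  · rintro ⟨h1, h2, m, hm, h⟩
    exact ⟨h1, h2, hm.isCAT0, fun p => exists_isometry_cone (hm.isPSDKernel_directions (h p))⟩

end

/-! ### Square-integrable maps into a metric space -/

namespace ContinuumProduct

variable {Y : Type*} [MeasurableSpace Y] {μ : Measure Y} {X : Type*} [MetricSpace X]

/-- The map `f : Y → X` represents an element of `L²(Y, μ, X)`. -/
structure MemL2 (μ : Measure Y) (f : Y → X) : Prop where
  aestronglyMeasurable : AEStronglyMeasurable f μ
  exists_integrable : ∃ x₀ : X, Integrable (fun y => dist (f y) x₀ ^ 2) μ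

/-- The class of a square-integrable map. -/
def ofFun (f : Y → X) (hf : MemL2 μ f) : ContinuumProduct μ X :=
  ⟨AEEqFun.mk f hf.1, by
    obtain ⟨x₀, h⟩ := hf.2
    refine ⟨x₀, h.congr ?_⟩
    filter_upwards [AEEqFun.coeFn_mk f hf.1] with y hy
    rw [hy]⟩

lemma coeFn_ofFun (f : Y → X) (hf : MemL2 μ f) : (ofFun f hf).1 =ᵐ[μ] f :=
  AEEqFun.coeFn_mk f hf.1

lemma ext {ξ η : ContinuumProduct μ X} (h : ξ.1 =ᵐ[μ] η.1) : ξ = η :=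
  Subtype.ext (AEEqFun.ext h)

lemma ofFun_eq {f : Y → X} {hf : MemL2 μ f} {ξ : ContinuumProduct μ X} (h : f =ᵐ[μ] ξ.1) :
    ofFun f hf = ξ :=
  ext ((coeFn_ofFun f hf).trans h)

lemma memL2 (ξ : ContinuumProduct μ X) : MemL2 μ ξ.1 :=
  ⟨ξ.1.aestronglyMeasurable, ξ.2⟩

lemma memL2_iff_memLp {f : Y → X} (hf : AEStronglyMeasurable f μ) :
    MemL2 μ f ↔ ∃ x₀ : X, MemLp (fun y => dist (f y) x₀) 2 μ := by
  have (x₀ : X) := memLp_two_iff_integrable_sq (hf.dist (aestronglyMeasurable_const (b := x₀)))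
  exact ⟨fun ⟨_, x₀, h⟩ => ⟨x₀, (this x₀).2 h⟩, fun ⟨x₀, h⟩ => ⟨hf, x₀, (this x₀).1 h⟩⟩

lemma MemL2.of_dist {f g : Y → X} (hf : AEStronglyMeasurable f μ) (hg : MemL2 μ g)
    (h : MemLp (fun y => dist (f y) (g y)) 2 μ) : MemL2 μ f := by
  obtain ⟨x₀, hx⟩ := (memL2_iff_memLp hg.1).1 hg
  refine (memL2_iff_memLp hf).2 ⟨x₀, (h.add hx).mono (hf.dist aestronglyMeasurable_const)
    (Eventually.of_forall fun y => ?_)⟩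
  simp only [Pi.add_apply, Real.norm_eq_abs]
  rw [abs_of_nonneg dist_nonneg, abs_of_nonneg (by positivity)]
  exact dist_triangle _ _ _

variable [IsFiniteMeasure μ]

lemma dist_sq_eq (ξ η : ContinuumProduct μ X) :
    dist ξ η ^ 2 = ∫ y, dist (ξ.1 y) (η.1 y) ^ 2 ∂μ := by
  rw [dist_def, Real.sq_sqrt (integral_nonneg fun y => by positivity)]

lemma dist_ofFun_sq {f g : Y → X} (hf : MemL2 μ f) (hg : MemL2 μ g) :
    dist (ofFun f hf) (ofFun g hg) ^ 2 = ∫ y, dist (f y) (g y) ^ 2 ∂μ := by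
  rw [dist_sq_eq]
  refine integral_congr_ae ?_
  filter_upwards [coeFn_ofFun f hf, coeFn_ofFun g hg] with y h1 h2
  rw [h1, h2]

lemma MemL2.integrable_dist_sq {f g : Y → X} (hf : MemL2 μ f) (hg : MemL2 μ g) :
    Integrable (fun y => dist (f y) (g y) ^ 2) μ := by
  refine (ContinuumProduct.integrable_dist_sq (ofFun f hf) (ofFun g hg)).congr ?_
  filter_upwards [coeFn_ofFun f hf, coeFn_ofFun g hg] with y h1 h2
  rw [h1, h2]

lemma memL2_const (x : X) : MemL2 μ fun _ : Y => x :=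
  ⟨aestronglyMeasurable_const, x, by simp⟩

instance [Nonempty X] : Nonempty (ContinuumProduct μ X) :=
  ⟨ofFun _ (memL2_const (Classical.arbitrary X))⟩

end ContinuumProduct

/-! ### Completeness and separability of the continuum product -/

/-- The Kuratowski embedding, with values in a Banach space that is not larger than necessary. -/
lemma exists_isometry_banach (X : Type u) [MetricSpace X] [Nonempty X] :
    ∃ (E : Type u) (_ : NormedAddCommGroup E) (_ : NormedSpace ℝ E) (_ : CompleteSpace E)
      (f : X → E), Isometry f ∧
        (TopologicalSpace.SeparableSpace X → TopologicalSpace.SeparableSpace E) := by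
  obtain ⟨x₀⟩ := ‹Nonempty X›
  let k : X → BoundedContinuousFunction X ℝ := fun x =>
    BoundedContinuousFunction.ofNormedAddCommGroup (fun z => dist x z - dist x₀ z) (by fun_prop)
      (dist x x₀) fun z => abs_dist_sub_le x x₀ z
  have hk : Isometry k := Isometry.of_dist_eq fun x y => by
    refine le_antisymm ((BoundedContinuousFunction.dist_le dist_nonneg).2 fun z => ?_) ?_
    · simpa [k, Real.dist_eq] using abs_dist_sub_le x y z
    · have := BoundedContinuousFunction.dist_coe_le_dist (f := k x) (g := k y) y
      simpa [k, Real.dist_eq] using this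
  let E := (Submodule.span ℝ (range k)).topologicalClosure
  have hmem : ∀ x, k x ∈ E := fun x =>
    Submodule.le_topologicalClosure _ (Submodule.subset_span (mem_range_self x))
  refine ⟨E, inferInstance, inferInstance,
    (Submodule.isClosed_topologicalClosure _).completeSpace_coe, fun x => ⟨k x, hmem x⟩,
    Isometry.of_dist_eq fun x y => hk.dist_eq x y, fun hX => ?_⟩
  have h1 : TopologicalSpace.IsSeparable (range k) :=
    TopologicalSpace.isSeparable_range hk.continuous
  have h2 : TopologicalSpace.IsSeparable (E : Set (BoundedContinuousFunction X ℝ)) := by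
    rw [Submodule.topologicalClosure_coe]
    exact (h1.span (R := ℝ)).closure
  exact h2.separableSpace

namespace ContinuumProduct

variable {Y : Type*} [MeasurableSpace Y] {μ : Measure Y} [IsFiniteMeasure μ]
  {X : Type*} [MetricSpace X] {E : Type*} [NormedAddCommGroup E] {f : X → E}

lemma memLp_comp (hf : Isometry f) (ξ : ContinuumProduct μ X) :
    MemLp (fun y => f (ξ.1 y)) 2 μ := by
  obtain ⟨x₀, hx⟩ := (memL2_iff_memLp ξ.1.aestronglyMeasurable).1 ξ.memL2
  have hm : AEStronglyMeasurable (fun y => f (ξ.1 y)) μ :=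
    hf.continuous.comp_aestronglyMeasurable ξ.1.aestronglyMeasurable
  have h1 : MemLp (fun y => f (ξ.1 y) - f x₀) 2 μ :=
    hx.mono (hm.sub aestronglyMeasurable_const) (Eventually.of_forall fun y => by
      rw [← dist_eq_norm, hf.dist_eq, Real.norm_eq_abs, abs_of_nonneg dist_nonneg])
  have h2 := h1.add (memLp_const (f x₀))
  refine h2.ae_eq (Eventually.of_forall fun y => ?_)
  simp

/-- An isometric embedding `X → E` induces an isometric embedding of `L²` spaces. -/
def toLp (hf : Isometry f) (ξ : ContinuumProduct μ X) : Lp E 2 μ :=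
  (memLp_comp hf ξ).toLp _

lemma coeFn_toLp (hf : Isometry f) (ξ : ContinuumProduct μ X) :
    toLp hf ξ =ᵐ[μ] fun y => f (ξ.1 y) :=
  MemLp.coeFn_toLp _

lemma isometry_toLp (hf : Isometry f) : Isometry (toLp (μ := μ) hf) := by
  refine Isometry.of_dist_eq fun ξ η => ?_
  rw [Lp.dist_def, show dist ξ η = l2Dist ξ η from rfl, l2Dist_eq]
  congr 1
  refine eLpNorm_congr_norm_ae ?_
  filter_upwards [coeFn_toLp hf ξ, coeFn_toLp hf η] with y h1 h2
  rw [Pi.sub_apply, h1, h2, ← dist_eq_norm, hf.dist_eq, Real.norm_eq_abs, abs_of_nonneg dist_nonneg]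

/-- A limit in `L²(Y, μ, E)` of maps with values in the closed subset `f X` has values in `f X`: pass
to a subsequence that converges almost everywhere. -/
lemma isClosed_range_toLp [CompleteSpace X] (hf : Isometry f) :
    IsClosed (range (toLp (μ := μ) hf)) := by
  refine isClosed_of_closure_subset fun g hg => ?_
  obtain ⟨u, hu, hlim⟩ := mem_closure_iff_seq_limit.1 hg
  choose ξ hξ using hu
  obtain ⟨ns, -, hns⟩ := (tendstoInMeasure_of_tendsto_Lp hlim).exists_seq_tendsto_ae
  have hall : ∀ᵐ y ∂μ, ∀ k, u (ns k) y = f ((ξ (ns k)).1 y) := by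
    refine ae_all_iff.2 fun k => ?_
    rw [← hξ]
    exact coeFn_toLp hf _
  have hex : ∀ᵐ y ∂μ, ∃ l, Tendsto (fun k => (ξ (ns k)).1 y) atTop (𝓝 l) := by
    filter_upwards [hns, hall] with y h1 h2
    simp only [h2] at h1
    refine cauchySeq_tendsto_of_complete (hf.isUniformInducing.cauchy_map_iff.1 ?_)
    rw [map_map]
    exact h1.cauchySeq
  obtain ⟨h, hh, hlim'⟩ := exists_stronglyMeasurable_limit_of_tendsto_ae
    (fun k => (ξ (ns k)).1.aestronglyMeasurable) hex
  have hgh : ∀ᵐ y ∂μ, g y = f (h y) := by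
    filter_upwards [hns, hall, hlim'] with y h1 h2 h3
    simp only [h2] at h1
    exact tendsto_nhds_unique h1 ((hf.continuous.tendsto _).comp h3)
  obtain ⟨x₀⟩ : Nonempty X := by
    obtain ⟨x₀, -⟩ := (ξ 0).2
    exact ⟨x₀⟩
  have hmem : MemL2 μ h := by
    refine (memL2_iff_memLp hh.aestronglyMeasurable).2 ⟨x₀, ?_⟩
    refine ((Lp.memLp g).sub (memLp_const (f x₀))).mono
      (hh.aestronglyMeasurable.dist aestronglyMeasurable_const) ?_
    filter_upwards [hgh] with y hy
    rw [Pi.sub_apply, hy, ← dist_eq_norm, hf.dist_eq, Real.norm_eq_abs, abs_of_nonneg dist_nonneg]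
  refine ⟨ofFun h hmem, Lp.ext ?_⟩
  filter_upwards [coeFn_toLp hf (ofFun h hmem), coeFn_ofFun h hmem, hgh] with y h1 h2 h3
  rw [h1, h2, h3]

instance [CompleteSpace X] : CompleteSpace (ContinuumProduct μ X) := by
  rcases isEmpty_or_nonempty X with hX | hX
  · have : IsEmpty (ContinuumProduct μ X) := ⟨fun ξ => let ⟨x₀, _⟩ := ξ.2; isEmptyElim x₀⟩
    infer_instance
  · obtain ⟨E, _, _, _, f, hf, -⟩ := exists_isometry_banach X
    rw [completeSpace_iff_isComplete_range (isometry_toLp (μ := μ) hf).isUniformInducing]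
    exact (isClosed_range_toLp hf).isComplete

lemma separableSpace [Nonempty X] (hμ : IsSeparable μ) (hX : TopologicalSpace.SeparableSpace X) :
    TopologicalSpace.SeparableSpace (ContinuumProduct μ X) := by
  obtain ⟨E, _, _, _, f, hf, hE⟩ := exists_isometry_banach X
  have := hE hX
  have : Fact ((2 : ENNReal) ≠ ⊤) := ⟨ENNReal.ofNat_ne_top⟩
  have : SecondCountableTopology (Lp E 2 μ) := inferInstance
  have := (isometry_toLp (μ := μ) hf).isEmbedding.secondCountableTopology
  infer_instance

end ContinuumProduct

/-! ### The continuum product is a Hilbert--Hadamard space -/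

namespace ContinuumProduct

variable {Y : Type*} [MeasurableSpace Y] {μ : Measure Y}
  {X : Type*} [MetricSpace X] {m : X → X → ℝ → X}

lemma memL2_bicombing [IsFiniteMeasure μ] (hm : IsCNBicombing m) (ξ η : ContinuumProduct μ X)
    {t : ℝ} (ht : t ∈ Icc (0 : ℝ) 1) : MemL2 μ fun y => m (ξ.1 y) (η.1 y) t := by
  have hmeas : AEStronglyMeasurable (fun y => m (ξ.1 y) (η.1 y) t) μ :=
    (hm.continuous ht).comp_aestronglyMeasurable
      (ξ.1.aestronglyMeasurable.prodMk η.1.aestronglyMeasurable)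
  refine MemL2.of_dist hmeas ξ.memL2 (((memLp_dist ξ η).const_mul t).ae_eq
    (Eventually.of_forall fun y => ?_))
  exact ((dist_comm _ _).trans ((hm.lin _ _).dist_left ht)).symm

variable [IsFiniteMeasure μ]

open Classical in
/-- The pointwise bicombing. (It is constant outside `[0, 1]`.) -/
def bicombing (hm : IsCNBicombing m) (ξ η : ContinuumProduct μ X) (t : ℝ) :
    ContinuumProduct μ X :=
  if ht : t ∈ Icc (0 : ℝ) 1 then ofFun _ (memL2_bicombing hm ξ η ht) else ξ

lemma coeFn_bicombing (hm : IsCNBicombing m) (ξ η : ContinuumProduct μ X) {t : ℝ}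
    (ht : t ∈ Icc (0 : ℝ) 1) :
    (bicombing hm ξ η t).1 =ᵐ[μ] fun y => m (ξ.1 y) (η.1 y) t := by
  rw [bicombing, dif_pos ht]
  exact coeFn_ofFun _ _

/-- The CN inequality is linear in squared distances, so it can be integrated. -/
theorem isCNBicombing (hm : IsCNBicombing m) : IsCNBicombing (bicombing (μ := μ) hm) where
  lin ξ η := by
    refine ⟨?_, ?_, fun s hs t ht => ?_⟩
    · refine ext ?_
      filter_upwards [coeFn_bicombing hm ξ η ⟨le_rfl, zero_le_one⟩] with y hy
      rw [hy, (hm.lin _ _).zero]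
    · refine ext ?_
      filter_upwards [coeFn_bicombing hm ξ η ⟨zero_le_one, le_rfl⟩] with y hy
      rw [hy, (hm.lin _ _).one]
    · refine (sq_eq_sq₀ dist_nonneg (by positivity)).1 ?_
      rw [mul_pow, dist_sq_eq, dist_sq_eq, ← integral_const_mul]
      refine integral_congr_ae ?_
      filter_upwards [coeFn_bicombing hm ξ η hs, coeFn_bicombing hm ξ η ht] with y h1 h2
      rw [h1, h2, (hm.lin _ _).dist_eq _ hs _ ht, mul_pow]
  cn ζ ξ η t ht := by
    rw [dist_sq_eq, dist_sq_eq, dist_sq_eq, dist_sq_eq, ← integral_const_mul, ← integral_const_mul,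
      ← integral_const_mul, ← integral_add, ← integral_sub]
    · refine integral_mono_ae (integrable_dist_sq _ _) ?_ ?_
      · exact (((integrable_dist_sq _ _).const_mul _).add
          ((integrable_dist_sq _ _).const_mul _)).sub ((integrable_dist_sq _ _).const_mul _)
      · filter_upwards [coeFn_bicombing hm ξ η ht] with y hy
        rw [hy]
        exact hm.cn _ _ _ t ht
    · exact ((integrable_dist_sq _ _).const_mul _).add ((integrable_dist_sq _ _).const_mul _)
    · exact (integrable_dist_sq _ _).const_mul _
    · exact (integrable_dist_sq _ _).const_mul _
    · exact (integrable_dist_sq _ _).const_mul _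

lemma integrable_bracket (ζ ξ η : ContinuumProduct μ X) :
    Integrable (fun y => bracket (ζ.1 y) (ξ.1 y) (η.1 y)) μ :=
  (((integrable_dist_sq _ _).add (integrable_dist_sq _ _)).sub (integrable_dist_sq _ _)).div_const 2

lemma bracket_eq_integral (ζ ξ η : ContinuumProduct μ X) :
    bracket ζ ξ η = ∫ y, bracket (ζ.1 y) (ξ.1 y) (η.1 y) ∂μ := by
  unfold bracket
  rw [integral_div, integral_sub, integral_add, dist_sq_eq, dist_sq_eq, dist_sq_eq]
  · exact integrable_dist_sq _ _
  · exact integrable_dist_sq _ _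
  · exact (integrable_dist_sq _ _).add (integrable_dist_sq _ _)
  · exact integrable_dist_sq _ _

lemma bracket_bicombing_ae (hm : IsCNBicombing m) (ζ ξ η : ContinuumProduct μ X) {s : ℝ}
    (hs : s ∈ Ioc (0 : ℝ) 1) :
    (fun y => bracket (ζ.1 y) ((bicombing hm ζ ξ s).1 y) ((bicombing hm ζ η s).1 y) / (s * s))
      =ᵐ[μ] fun y => scaledBracket m (ζ.1 y) (ξ.1 y) (η.1 y) s s := by
  filter_upwards [coeFn_bicombing hm ζ ξ ⟨hs.1.le, hs.2⟩,
    coeFn_bicombing hm ζ η ⟨hs.1.le, hs.2⟩] with y h1 h2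
  rw [h1, h2, scaledBracket]

lemma integrable_scaledBracket (hm : IsCNBicombing m) (ζ ξ η : ContinuumProduct μ X) {s : ℝ}
    (hs : s ∈ Ioc (0 : ℝ) 1) :
    Integrable (fun y => scaledBracket m (ζ.1 y) (ξ.1 y) (η.1 y) s s) μ :=
  ((integrable_bracket _ _ _).div_const _).congr (bracket_bicombing_ae hm ζ ξ η hs)

lemma scaledBracket_eq_integral (hm : IsCNBicombing m) (ζ ξ η : ContinuumProduct μ X) {s : ℝ}
    (hs : s ∈ Ioc (0 : ℝ) 1) : scaledBracket (bicombing hm) ζ ξ η s s =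
      ∫ y, scaledBracket m (ζ.1 y) (ξ.1 y) (η.1 y) s s ∂μ := by
  rw [← integral_congr_ae (bracket_bicombing_ae hm ζ ξ η hs), integral_div, ← bracket_eq_integral,
    scaledBracket]

lemma integrable_dist_mul_dist (ζ ξ η : ContinuumProduct μ X) :
    Integrable (fun y => dist (ζ.1 y) (ξ.1 y) * dist (ζ.1 y) (η.1 y)) μ :=
  (memLp_dist ζ ξ).integrable_mul (memLp_dist ζ η)

lemma integrable_initialKernel (hm : IsCNBicombing m) (ζ ξ η : ContinuumProduct μ X) :
    Integrable (fun y => initialKernel m (ζ.1 y) (ξ.1 y) (η.1 y)) μ := by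
  obtain ⟨s, hs, hlim⟩ : ∃ s : ℕ → ℝ, (∀ n, s n ∈ Ioc (0 : ℝ) 1) ∧
      Tendsto s atTop (𝓝[>] 0) := by
    refine ⟨fun n => 1 / ((n : ℝ) + 1), fun n => ⟨by positivity, ?_⟩, tendsto_nhdsWithin_iff.2
        ⟨tendsto_one_div_add_atTop_nhds_zero_nat, Eventually.of_forall fun n => ?_⟩⟩
    · rw [div_le_one (by positivity)]; linarith [n.cast_nonneg (α := ℝ)]
    · exact mem_Ioi.2 (by positivity)
  refine (integrable_dist_mul_dist ζ ξ η).mono' (aestronglyMeasurable_of_tendsto_ae atTop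
    (fun n => (integrable_scaledBracket hm ζ ξ η (hs n)).1)
    (Eventually.of_forall fun y => (hm.tendsto_initialKernel_diag _ _ _).comp hlim)) ?_
  exact Eventually.of_forall fun y => hm.abs_initialKernel_le _ _ _

/-- The inner product of initial velocities is computed pointwise, by dominated convergence. -/
lemma initialKernel_eq_integral (hm : IsCNBicombing m) (ζ ξ η : ContinuumProduct μ X) :
    initialKernel (bicombing hm) ζ ξ η = ∫ y, initialKernel m (ζ.1 y) (ξ.1 y) (η.1 y) ∂μ := by
  refine tendsto_nhds_unique ((isCNBicombing hm).tendsto_initialKernel_diag ζ ξ η) ?_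
  have h : Tendsto (fun s => ∫ y, scaledBracket m (ζ.1 y) (ξ.1 y) (η.1 y) s s ∂μ) (𝓝[>] 0)
      (𝓝 (∫ y, initialKernel m (ζ.1 y) (ξ.1 y) (η.1 y) ∂μ)) := by
    refine tendsto_integral_filter_of_dominated_convergence
      (fun y => dist (ζ.1 y) (ξ.1 y) * dist (ζ.1 y) (η.1 y)) ?_ ?_
      (integrable_dist_mul_dist ζ ξ η)
      (Eventually.of_forall fun y => hm.tendsto_initialKernel_diag _ _ _)
    · filter_upwards [Ioc_mem_nhdsGT_zero] with s hs
      exact (integrable_scaledBracket hm ζ ξ η hs).1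
    · filter_upwards [Ioc_mem_nhdsGT_zero] with s hs
      exact Eventually.of_forall fun y => hm.abs_scaledBracket_le _ _ _ hs hs
  refine h.congr' ?_
  filter_upwards [Ioc_mem_nhdsGT_zero] with s hs
  rw [scaledBracket_eq_integral hm ζ ξ η hs]

/-- An integral of positive semidefinite kernels is positive semidefinite. -/
theorem isPSDKernel (hm : IsCNBicombing m) (hK : ∀ p, IsPSDKernel (initialKernel m p))
    (ζ : ContinuumProduct μ X) : IsPSDKernel (initialKernel (bicombing hm) ζ) := by
  intro n ξ c
  simp only [initialKernel_eq_integral, ← integral_const_mul]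
  have hint : ∀ i j, Integrable (fun y => c i * c j *
      initialKernel m (ζ.1 y) ((ξ i).1 y) ((ξ j).1 y)) μ := fun i j =>
    (integrable_initialKernel hm ζ (ξ i) (ξ j)).const_mul _
  have : ∀ i, ∑ j, ∫ y, c i * c j * initialKernel m (ζ.1 y) ((ξ i).1 y) ((ξ j).1 y) ∂μ =
      ∫ y, ∑ j, c i * c j * initialKernel m (ζ.1 y) ((ξ i).1 y) ((ξ j).1 y) ∂μ := fun i =>
    (integral_finsetSum _ fun j _ => hint i j).symm
  simp only [this]
  rw [← integral_finsetSum _ fun i _ => integrable_finsetSum _ fun j _ => hint i j]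
  exact integral_nonneg fun y => hK _ n (fun i => (ξ i).1 y) c

/-- The continuum product of a Hilbert--Hadamard space is a Hilbert--Hadamard space. -/
theorem isHilbertHadamard {Y : Type v} [MeasurableSpace Y] {μ : Measure Y} [IsFiniteMeasure μ]
    {X : Type u} [MetricSpace X] (hX : IsHilbertHadamard X) :
    IsHilbertHadamard (ContinuumProduct μ X) := by
  obtain ⟨h1, h2, m, hm, hK⟩ := isHilbertHadamard_iff.1 hX
  exact isHilbertHadamard_iff.2 ⟨inferInstance, inferInstance, bicombing hm, isCNBicombing hm,
    isPSDKernel hm hK⟩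

end ContinuumProduct

/-! ### Products of Riemannian manifolds -/

section Pullback

variable {E : Type*} [NormedAddCommGroup E] [NormedSpace ℝ E] {H : Type*} [TopologicalSpace H]
  {I : ModelWithCorners ℝ E H} {M : Type*} [TopologicalSpace M] [ChartedSpace H M]
  {F : Type*} [NormedAddCommGroup F] [NormedSpace ℝ F] {G : Type*} [TopologicalSpace G]
  {J : ModelWithCorners ℝ F G} {N : Type*} [TopologicalSpace N] [ChartedSpace G N]

/-- The pullback of a field of bilinear forms. -/
def pullbackForm (I : ModelWithCorners ℝ E H) (J : ModelWithCorners ℝ F G) (f : M → N)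
    (g : ∀ y : N, TangentSpace J y →L[ℝ] TangentSpace J y →L[ℝ] ℝ) (x : M) :
    TangentSpace I x →L[ℝ] TangentSpace I x →L[ℝ] ℝ :=
  (ContinuousLinearMap.precomp ℝ (mfderiv I J f x)) ∘L (g (f x)) ∘L (mfderiv I J f x)

variable [IsManifold I ∞ M] [IsManifold J ∞ N]

/-- In trivializations, the pullback is the composition of the coordinate expressions of the form
and of the derivative, both of which are smooth. -/
lemma contMDiff_pullbackForm {f : M → N} (hf : ContMDiff I J ∞ f)
    {g : ∀ y : N, TangentSpace J y →L[ℝ] TangentSpace J y →L[ℝ] ℝ}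
    (hg : ContMDiff J (J.prod 𝓘(ℝ, F →L[ℝ] F →L[ℝ] ℝ)) ∞
      (fun y : N => Bundle.TotalSpace.mk' (F →L[ℝ] F →L[ℝ] ℝ)
        (E := fun y : N => TangentSpace J y →L[ℝ] TangentSpace J y →L[ℝ] ℝ) y (g y))) :
    ContMDiff I (I.prod 𝓘(ℝ, E →L[ℝ] E →L[ℝ] ℝ)) ∞
      (fun x : M => Bundle.TotalSpace.mk' (E →L[ℝ] E →L[ℝ] ℝ)
        (E := fun x : M => TangentSpace I x →L[ℝ] TangentSpace I x →L[ℝ] ℝ) x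
        (pullbackForm I J f g x)) := by
  intro x₀
  rw [contMDiffAt_hom_bundle]
  refine ⟨contMDiffAt_id, ?_⟩
  have h1 := ((contMDiffAt_hom_bundle _).1 (hg (f x₀))).2.comp x₀ (hf x₀)
  have h2 : ContMDiffAt I 𝓘(ℝ, E →L[ℝ] F) ∞
    (inTangentCoordinates I J id f (mfderiv I J f) x₀) x₀ :=
    (hf x₀).mfderiv_const (m := ∞) le_rfl
  have h3 := (h2.clm_precomp (F₃ := ℝ)).clm_comp (h1.clm_comp h2)
  refine h3.congr_of_eventuallyEq ?_
  have hx := (trivializationAt E (TangentSpace I) x₀).open_baseSet.mem_nhds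
    (FiberBundle.mem_baseSet_trivializationAt' x₀)
  have hy := hf.continuous.continuousAt.preimage_mem_nhds
    ((trivializationAt F (TangentSpace J) (f x₀)).open_baseSet.mem_nhds
    (FiberBundle.mem_baseSet_trivializationAt' (f x₀)))
  filter_upwards [hx, hy] with x hx hy
  rw [mem_preimage] at hy
  ext v w
  have hL : ∀ u : E, inTangentCoordinates I J id f (mfderiv I J f) x₀ x u =
      (trivializationAt F (TangentSpace J) (f x₀)).linearMapAt ℝ (f x)
        (mfderiv I J f x ((trivializationAt E (TangentSpace I) x₀).symm x u)) := by
    intro u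
    change ContinuousLinearMap.inCoordinates E (TangentSpace I) F (TangentSpace J) x₀ x (f x₀) (f x)
      (mfderiv I J f x) u = _
    rw [ContinuousLinearMap.inCoordinates_eq hx hy]
    simp [Bundle.Trivialization.coe_linearMapAt_of_mem _ hy,
      Bundle.Trivialization.coe_continuousLinearEquivAt_eq _ hy]
  change _ = ContinuousLinearMap.inCoordinates F (TangentSpace J) (F →L[ℝ] ℝ)
    (fun y => TangentSpace J y →L[ℝ] ℝ) (f x₀) (f x) (f x₀) (f x) (g (f x))
    (inTangentCoordinates I J id f (mfderiv I J f) x₀ x v)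
    (inTangentCoordinates I J id f (mfderiv I J f) x₀ x w)
  have hA : ∀ u : TangentSpace J (f x), (trivializationAt F (TangentSpace J) (f x₀)).symm (f x)
      ((trivializationAt F (TangentSpace J) (f x₀)).linearMapAt ℝ (f x) u) = u := by
    intro u
    convert! ((trivializationAt F (TangentSpace J) (f x₀)).continuousLinearEquivAt ℝ _
      hy).symm_apply_apply u
    simp [Bundle.Trivialization.coe_linearMapAt_of_mem _ hy]
  rw [inCoordinates_apply_eq₂ hx hx (mem_univ _), inCoordinates_apply_eq₂ hy hy (mem_univ _),
    hL, hL, hA, hA]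
  rfl

end Pullback

section Product

variable {E : Type*} [NormedAddCommGroup E] [NormedSpace ℝ E] {H : Type*} [TopologicalSpace H]
  {I : ModelWithCorners ℝ E H} {A : Type*} [TopologicalSpace A] [ChartedSpace H A]
  [IsManifold I ∞ A] [Bundle.RiemannianBundle (fun x : A => TangentSpace I x)]
  [IsContMDiffRiemannianBundle I ∞ E (fun x : A => TangentSpace I x)]
  {F : Type*} [NormedAddCommGroup F] [NormedSpace ℝ F] {G : Type*} [TopologicalSpace G]
  {J : ModelWithCorners ℝ F G} {B : Type*} [TopologicalSpace B] [ChartedSpace G B]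
  [IsManifold J ∞ B] [Bundle.RiemannianBundle (fun x : B => TangentSpace J x)]
  [IsContMDiffRiemannianBundle J ∞ F (fun x : B => TangentSpace J x)]

/-- The scalar product of a Riemannian bundle as a field of bilinear forms. -/
def metricForm (I : ModelWithCorners ℝ E H) (A : Type*) [TopologicalSpace A] [ChartedSpace H A]
    [IsManifold I ∞ A] [h : Bundle.RiemannianBundle (fun x : A => TangentSpace I x)] (x : A) :
    TangentSpace I x →L[ℝ] TangentSpace I x →L[ℝ] ℝ :=
  h.g.inner x

omit [IsContMDiffRiemannianBundle I ∞ E (fun x : A => TangentSpace I x)] in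
lemma metricForm_apply (x : A) (v w : TangentSpace I x) :
    metricForm I A x v w = inner ℝ v w := rfl

lemma contMDiff_metricForm : ContMDiff I (I.prod 𝓘(ℝ, E →L[ℝ] E →L[ℝ] ℝ)) ∞
    (fun x : A => Bundle.TotalSpace.mk' (E →L[ℝ] E →L[ℝ] ℝ)
        (E := fun x : A => TangentSpace I x →L[ℝ] TangentSpace I x →L[ℝ] ℝ) x
        (metricForm I A x)) := by
  obtain ⟨g, hg, h⟩ := ‹IsContMDiffRiemannianBundle I ∞ E
    (fun x : A => TangentSpace I x)›.exists_contMDiff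
  have : ∀ x, metricForm I A x = g x := fun x => by
    ext v w
    exact h x v w
  simpa only [this] using hg

variable (I J A B) in
/-- The weighted product metric `c g_A + g_B`. -/
def prodForm (c : ℝ) (x : A × B) :
    TangentSpace (I.prod J) x →L[ℝ] TangentSpace (I.prod J) x →L[ℝ] ℝ :=
  c • pullbackForm (I.prod J) I Prod.fst (metricForm I A) x +
    pullbackForm (I.prod J) J Prod.snd (metricForm J B) x

lemma contMDiff_prodForm (c : ℝ) :
    ContMDiff (I.prod J) ((I.prod J).prod 𝓘(ℝ, (E × F) →L[ℝ] (E × F) →L[ℝ] ℝ)) ∞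
    (fun x : A × B => Bundle.TotalSpace.mk' ((E × F) →L[ℝ] (E × F) →L[ℝ] ℝ)
        (E := fun x : A × B => TangentSpace (I.prod J) x →L[ℝ] TangentSpace (I.prod J) x →L[ℝ] ℝ) x
        (prodForm I A J B c x)) :=
  ((contMDiff_pullbackForm (contMDiff_fst (I := I) (J := J) (M := A) (N := B))
    contMDiff_metricForm).const_smul_section (a := c)).add_section
    (contMDiff_pullbackForm (contMDiff_snd (I := I) (J := J) (M := A) (N := B))
      contMDiff_metricForm)

omit [IsContMDiffRiemannianBundle I ∞ E (fun x : A => TangentSpace I x)]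
  [IsContMDiffRiemannianBundle J ∞ F (fun x : B => TangentSpace J x)] in
lemma prodForm_apply (c : ℝ) (x : A × B) (v w : TangentSpace (I.prod J) x) :
    prodForm I A J B c x v w =
      c * inner ℝ (show TangentSpace I x.1 from Prod.fst (α := E) (β := F) v)
          (show TangentSpace I x.1 from Prod.fst (α := E) (β := F) w) +
        inner ℝ (show TangentSpace J x.2 from Prod.snd (α := E) (β := F) v)
          (show TangentSpace J x.2 from Prod.snd (α := E) (β := F) w) := by
  have h1 := mfderiv_fst (I := I) (I' := J) (x := x)
  have h2 := mfderiv_snd (I := I) (I' := J) (x := x)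
  change c * metricForm I A x.1 (mfderiv (I.prod J) I Prod.fst x v)
      (mfderiv (I.prod J) I Prod.fst x w) +
    metricForm J B x.2 (mfderiv (I.prod J) J Prod.snd x v)
      (mfderiv (I.prod J) J Prod.snd x w) = _
  rw [h1, h2]
  rfl

omit [IsContMDiffRiemannianBundle I ∞ E (fun x : A => TangentSpace I x)] in
lemma exists_norm_le_of_metricForm_lt (x : A) :
    ∃ R : ℝ, ∀ v : E, metricForm I A x v v < 1 → ‖v‖ ≤ R := by
  have h := ‹Bundle.RiemannianBundle (fun x : A => TangentSpace I x)›.g.isVonNBounded x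
  exact (NormedSpace.isVonNBounded_iff' ℝ (E := E)).1 h

omit [IsContMDiffRiemannianBundle I ∞ E (fun x : A => TangentSpace I x)] in
lemma metricForm_nonneg (x : A) (v : TangentSpace I x) : 0 ≤ metricForm I A x v v := by
  rw [metricForm_apply]
  exact real_inner_self_nonneg

/-- The weighted product metric as a Riemannian metric. -/
def prodMetric (c : ℝ) (hc : 0 < c) :
    Bundle.ContMDiffRiemannianMetric (I.prod J) ∞ (E × F)
      (fun x : A × B => TangentSpace (I.prod J) x) where
  inner := prodForm I A J B c
  symm x v w := by
    rw [prodForm_apply, prodForm_apply]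
    congr 1
    · congr 1
      exact real_inner_comm _ _
    · exact real_inner_comm _ _
  pos x v hv := by
    rw [prodForm_apply]
    have h1 : 0 ≤ inner ℝ (show TangentSpace I x.1 from Prod.fst (α := E) (β := F) v)
          (show TangentSpace I x.1 from Prod.fst (α := E) (β := F) v) := real_inner_self_nonneg
    have h2 : 0 ≤ inner ℝ (show TangentSpace J x.2 from Prod.snd (α := E) (β := F) v)
          (show TangentSpace J x.2 from Prod.snd (α := E) (β := F) v) := real_inner_self_nonneg
    rcases h1.eq_or_lt with h | h
    · rcases h2.eq_or_lt with h' | h'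
      · exact absurd (Prod.ext (inner_self_eq_zero.1 h.symm) (inner_self_eq_zero.1 h'.symm)) hv
      · positivity
    · positivity
  isVonNBounded x := by
    obtain ⟨R, hR⟩ := exists_norm_le_of_metricForm_lt (I := I) x.1
    obtain ⟨R', hR'⟩ := exists_norm_le_of_metricForm_lt (I := J) x.2
    refine (NormedSpace.isVonNBounded_iff' ℝ (E := E × F)).2 ⟨max (R / √c) R', fun v hv => ?_⟩
    replace hv : c * metricForm I A x.1 v.1 v.1 + metricForm J B x.2 v.2 v.2 < 1 :=
      (prodForm_apply (I := I) (J := J) c x v v).symm.trans_lt hv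
    have n1 : 0 ≤ metricForm I A x.1 v.1 v.1 := metricForm_nonneg x.1 v.1
    have n2 : 0 ≤ metricForm J B x.2 v.2 v.2 := metricForm_nonneg x.2 v.2
    have hs : 0 < √c := Real.sqrt_pos.2 hc
    refine max_le_max ?_ ?_
    · have hq : metricForm I A x.1 (√c • v.1) (√c • v.1) = c * metricForm I A x.1 v.1 v.1 := by
        have e1 := ContinuousLinearMap.map_smul (metricForm I A x.1) (√c) v.1
        have e2 := ContinuousLinearMap.map_smul (metricForm I A x.1 v.1) (√c) v.1
        calc metricForm I A x.1 (√c • v.1) (√c • v.1)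
            = √c * metricForm I A x.1 v.1 (√c • v.1) := by
              exact congrArg (fun L => L (√c • v.1)) e1
          _ = √c * (√c * metricForm I A x.1 v.1 v.1) := by
              exact congrArg (fun z => √c * z) e2
          _ = _ := by rw [← mul_assoc, Real.mul_self_sqrt hc.le]
      have := hR (√c • v.1) (by rw [hq]; have := mul_nonneg hc.le n1; linarith)
      rw [norm_smul, Real.norm_eq_abs, abs_of_pos hs] at this
      rw [le_div_iff₀ hs]
      linarith
    · exact hR' v.2 (by have := mul_nonneg hc.le n1; linarith)
  contMDiff := contMDiff_prodForm c

end Product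

/-! ### The Riemannian distance of a product -/

/-- The inverse of a primitive of a continuous function bounded below by a positive constant. -/
lemma exists_inverse_primitive {v : ℝ → ℝ} (hv : Continuous v) {δ : ℝ} (hδ : 0 < δ)
    (hδv : ∀ t, δ ≤ v t) : ∃ σ : ℝ → ℝ, ContDiff ℝ 1 σ ∧ σ 0 = 0 ∧
      σ (∫ t in (0 : ℝ)..1, v t) = 1 ∧ ∀ u, HasDerivAt σ (v (σ u))⁻¹ u := by
  let s : ℝ → ℝ := fun t => ∫ x in (0 : ℝ)..t, v x
  have hs : ∀ t, HasDerivAt s (v t) t := fun t => intervalIntegral.integral_hasDerivAt_right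
    (hv.intervalIntegrable _ _) (hv.stronglyMeasurableAtFilter _ _) hv.continuousAt
  have hvpos : ∀ t, 0 < v t := fun t => hδ.trans_le (hδv t)
  have hmono : StrictMono s := strictMono_of_deriv_pos fun t => by
    rw [(hs t).deriv]; exact hvpos t
  have hcont : Continuous s := continuous_iff_continuousAt.2 fun t => (hs t).continuousAt
  have hs0 : s 0 = 0 := intervalIntegral.integral_same
  have hlin : Monotone fun t => s t - δ * t := by
    refine monotone_of_deriv_nonneg (fun t => ((hs t).sub ((hasDerivAt_id t).const_mul
      δ)).differentiableAt) fun t => ?_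
    have := ((hs t).sub ((hasDerivAt_id t).const_mul δ)).deriv
    rw [show (fun t => s t - δ * t) = s - fun t => δ * id t from rfl, this]
    linarith [hδv t]
  have hsurj : Function.Surjective s := by
    refine hcont.surjective ?_ ?_
    · refine tendsto_atTop_mono' _ ?_ (tendsto_id.const_mul_atTop hδ)
      filter_upwards [eventually_ge_atTop 0] with t ht
      have := hlin ht
      simp only [hs0, mul_zero, sub_zero] at this
      simp only [id]
      linarith
    · refine tendsto_atBot_mono' _ ?_ (tendsto_id.const_mul_atBot hδ)
      filter_upwards [eventually_le_atBot 0] with t ht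
      have := hlin ht
      simp only [hs0, mul_zero, sub_zero] at this
      simp only [id]
      linarith
  let h : ℝ ≃ₜ ℝ := (StrictMono.orderIsoOfSurjective s hmono hsurj).toHomeomorph
  have hsC : ContDiff ℝ 1 s := by
    refine contDiff_one_iff_deriv.2 ⟨fun t => (hs t).differentiableAt, ?_⟩
    rw [show deriv s = v from funext fun t => (hs t).deriv]
    exact hv
  have hleft : ∀ t, h.symm (s t) = t := fun t => h.symm_apply_apply t
  have hright : ∀ t, s (h.symm t) = t := fun t => h.apply_symm_apply t
  refine ⟨h.symm, h.contDiff_symm_deriv (fun t => (hvpos t).ne') hs hsC, ?_, hleft 1, fun u => ?_⟩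
  · simpa [hs0] using hleft 0
  · exact HasDerivAt.of_local_left_inverse h.symm.continuous.continuousAt (hs _) (hvpos _).ne'
      (Eventually.of_forall hright)

section Paths

variable {E : Type*} [NormedAddCommGroup E] [NormedSpace ℝ E] {H : Type*} [TopologicalSpace H]
  {I : ModelWithCorners ℝ E H} {A : Type*} [TopologicalSpace A] [ChartedSpace H A]
  [IsManifold I ∞ A] [Bundle.RiemannianBundle (fun x : A => TangentSpace I x)]
  [IsContMDiffRiemannianBundle I ∞ E (fun x : A => TangentSpace I x)]

lemma isContinuousRiemannianBundle_of_isContMDiff :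
    IsContinuousRiemannianBundle E (fun x : A => TangentSpace I x) := by
  obtain ⟨g, hg, h⟩ := ‹IsContMDiffRiemannianBundle I ∞ E
    (fun x : A => TangentSpace I x)›.exists_contMDiff
  exact ⟨g, hg.continuous, h⟩

lemma continuous_speed {γ : ℝ → A} (hγ : ContMDiff 𝓘(ℝ, ℝ) I 1 γ) :
    Continuous fun t : ℝ => ‖(mfderiv 𝓘(ℝ, ℝ) I γ t 1 : TangentSpace I (γ t))‖ := by
  have := isContinuousRiemannianBundle_of_isContMDiff (I := I) (A := A)
  have h1 : Continuous fun t : ℝ => (⟨t, (1 : ℝ)⟩ : TangentBundle 𝓘(ℝ, ℝ) ℝ) :=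
    (tangentBundleModelSpaceHomeomorph 𝓘(ℝ, ℝ)).symm.continuous.comp
      (continuous_id.prodMk continuous_const)
  have h2 := (hγ.continuous_tangentMap le_rfl).comp h1
  have h3 : Continuous fun t : ℝ => inner ℝ (mfderiv 𝓘(ℝ, ℝ) I γ t 1 : TangentSpace I (γ t))
      (mfderiv 𝓘(ℝ, ℝ) I γ t 1 : TangentSpace I (γ t)) :=
    Continuous.inner_bundle (F := E) (E := fun x : A => TangentSpace I x) h2 h2
  simp only [norm_eq_sqrt_real_inner]
  exact h3.sqrt

/-- A path that is shorter than `r` can be parametrized by `[0, 1]` with speed at most `r`: take the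
inverse of the primitive of its speed, increased by a constant to make it positive. -/
lemma exists_path_speed_le {x y : A} {r : ℝ}
    (hr : Manifold.riemannianEDist I x y < ENNReal.ofReal r) :
    ∃ γ : ℝ → A, γ 0 = x ∧ γ 1 = y ∧ ContMDiff 𝓘(ℝ, ℝ) I 1 γ ∧
      ∀ t, ‖(mfderiv 𝓘(ℝ, ℝ) I γ t 1 : TangentSpace I (γ t))‖ ≤ r := by
  obtain ⟨γ, h0, h1, hγ, hlen, -, -⟩ :=
    Manifold.exists_lt_locally_constant_of_riemannianEDist_lt hr zero_lt_one
  let v : ℝ → ℝ := fun t => ‖(mfderiv 𝓘(ℝ, ℝ) I γ t 1 : TangentSpace I (γ t))‖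
  have hv : Continuous v := continuous_speed hγ
  have hv0 : ∀ t, 0 ≤ v t := fun t => norm_nonneg _
  have hr0 : 0 < r := ENNReal.ofReal_pos.1 (zero_le.trans_lt hlen)
  have hint : ∫ t in (0 : ℝ)..1, v t < r := by
    rw [Manifold.pathELength_eq_lintegral_mfderiv_Icc] at hlen
    rw [intervalIntegral.integral_of_le zero_le_one, ← integral_Icc_eq_integral_Ioc,
      integral_eq_lintegral_of_nonneg_ae (Eventually.of_forall hv0) hv.aestronglyMeasurable]
    refine (ENNReal.toReal_lt_of_lt_ofReal ?_)
    refine (lintegral_congr fun t => ?_).trans_lt hlen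
    exact ofReal_norm _
  obtain ⟨δ, hδ⟩ : ∃ δ, δ = r - ∫ t in (0 : ℝ)..1, v t := ⟨_, rfl⟩
  have hδ0 : 0 < δ := by rw [hδ]; linarith
  obtain ⟨σ, hσ, hσ0, hσ1, hσd⟩ := exists_inverse_primitive (v := fun t => v t + δ)
    (by fun_prop) hδ0 (fun t => by linarith [hv0 t])
  have htot : ∫ t in (0 : ℝ)..1, (v t + δ) = r := by
    rw [intervalIntegral.integral_add (hv.intervalIntegrable _ _) (by simp)]
    simp [hδ]
  rw [htot] at hσ1
  let τ : ℝ → ℝ := fun u => σ (r * u)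
  have hτ : ContDiff ℝ 1 τ := hσ.comp (contDiff_const.mul contDiff_id)
  have hτd : ∀ u, HasDerivAt τ ((v (τ u) + δ)⁻¹ * r) u := fun u => by
    have h : HasDerivAt (fun u => r * u) r u := by simpa using (hasDerivAt_id u).const_mul r
    exact (hσd (r * u)).comp u h
  refine ⟨γ ∘ τ, by simp [τ, hσ0, h0], by simp [τ, hσ1, h1], hγ.comp hτ.contMDiff, fun t => ?_⟩
  have hmf : mfderiv 𝓘(ℝ, ℝ) I (γ ∘ τ) t 1 =
      ((v (τ t) + δ)⁻¹ * r) • (mfderiv 𝓘(ℝ, ℝ) I γ (τ t) 1 : TangentSpace I (γ (τ t))) := by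
    rw [mfderiv_comp t ((hγ.mdifferentiable one_ne_zero) _)
      (hτ.contMDiff.mdifferentiable one_ne_zero t)]
    have e : mfderiv 𝓘(ℝ, ℝ) 𝓘(ℝ, ℝ) τ t 1 = ((v (τ t) + δ)⁻¹ * r) • (1 : ℝ) := by
      rw [mfderiv_eq_fderiv]
      have := (hτd t).hasFDerivAt.fderiv
      rw [this]
      change (1 : ℝ) • ((v (τ t) + δ)⁻¹ * r) = ((v (τ t) + δ)⁻¹ * r) • (1 : ℝ)
      rw [smul_eq_mul, smul_eq_mul, mul_comm]
    have e2 := ContinuousLinearMap.map_smul (mfderiv 𝓘(ℝ, ℝ) I γ (τ t)) ((v (τ t) + δ)⁻¹ * r)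
      (1 : ℝ)
    exact (congrArg (mfderiv 𝓘(ℝ, ℝ) I γ (τ t)) e).trans e2
  have hpos : 0 < v (τ t) + δ := by linarith [hv0 (τ t)]
  change ‖(mfderiv 𝓘(ℝ, ℝ) I (γ ∘ τ) t 1 : TangentSpace I (γ (τ t)))‖ ≤ r
  rw [hmf, norm_smul, Real.norm_eq_abs, abs_of_pos (by positivity)]
  change (v (τ t) + δ)⁻¹ * r * v (τ t) ≤ r
  rw [mul_right_comm, inv_mul_eq_div]
  exact mul_le_of_le_one_left hr0.le (div_le_one_of_le₀ (by linarith) hpos.le)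

end Paths

section ProductDistance

variable {E : Type*} [NormedAddCommGroup E] [NormedSpace ℝ E] {H : Type*} [TopologicalSpace H]
  {I : ModelWithCorners ℝ E H} {A : Type*} [TopologicalSpace A] [ChartedSpace H A]
  [IsManifold I ∞ A] [Bundle.RiemannianBundle (fun x : A => TangentSpace I x)]
  [IsContMDiffRiemannianBundle I ∞ E (fun x : A => TangentSpace I x)]
  {F : Type*} [NormedAddCommGroup F] [NormedSpace ℝ F] {G : Type*} [TopologicalSpace G]
  {J : ModelWithCorners ℝ F G} {B : Type*} [TopologicalSpace B] [ChartedSpace G B]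
  [IsManifold J ∞ B] [Bundle.RiemannianBundle (fun x : B => TangentSpace J x)]
  [IsContMDiffRiemannianBundle J ∞ F (fun x : B => TangentSpace J x)]

variable (I J A B) in
/-- The Riemannian structure on `A × B` given by the weighted product metric. -/
abbrev prodRiemannianBundle (c : ℝ) (hc : 0 < c) :
    Bundle.RiemannianBundle (fun x : A × B => TangentSpace (I.prod J) x) :=
  ⟨(prodMetric (I := I) (J := J) (A := A) (B := B) c hc).toRiemannianMetric⟩

lemma norm_prod_eq (c : ℝ) (hc : 0 < c) (x : A × B) (v : TangentSpace I x.1)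
    (w : TangentSpace J x.2) :
    letI := prodRiemannianBundle I A J B c hc
    ‖(show TangentSpace (I.prod J) x from ((v, w) : E × F))‖ = √(c * ‖v‖ ^ 2 + ‖w‖ ^ 2) := by
  let _ := prodRiemannianBundle I A J B c hc
  rw [norm_eq_sqrt_real_inner, ← real_inner_self_eq_norm_sq v, ← real_inner_self_eq_norm_sq w]
  exact congrArg Real.sqrt (prodForm_apply c x _ _)

lemma speed_prod_eq (c : ℝ) (hc : 0 < c) {γ : ℝ → A} {η : ℝ → B}
    (hγ : ContMDiff 𝓘(ℝ, ℝ) I 1 γ) (hη : ContMDiff 𝓘(ℝ, ℝ) J 1 η) (t : ℝ) :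
    letI := prodRiemannianBundle I A J B c hc
    ‖(mfderiv 𝓘(ℝ, ℝ) (I.prod J) (fun s => (γ s, η s)) t 1 :
        TangentSpace (I.prod J) (γ t, η t))‖ =
      √(c * ‖(mfderiv 𝓘(ℝ, ℝ) I γ t 1 : TangentSpace I (γ t))‖ ^ 2 +
        ‖(mfderiv 𝓘(ℝ, ℝ) J η t 1 : TangentSpace J (η t))‖ ^ 2) := by
  let _ := prodRiemannianBundle I A J B c hc
  rw [mfderiv_prodMk (hγ.mdifferentiable one_ne_zero t) (hη.mdifferentiable one_ne_zero t)]
  exact norm_prod_eq (I := I) (J := J) c hc (γ t, η t) _ _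

/-- A path in the product projects to paths in the factors; their lengths are combined by the
Cauchy-Schwarz inequality. -/
lemma sqrt_le_riemannianEDist_prod (c : ℝ) (hc : 0 < c) (x y : A × B)
    (hx : Manifold.riemannianEDist I x.1 y.1 ≠ ⊤) (hy : Manifold.riemannianEDist J x.2 y.2 ≠ ⊤) :
    letI := prodRiemannianBundle I A J B c hc
    ENNReal.ofReal √(c * (Manifold.riemannianEDist I x.1 y.1).toReal ^ 2 +
      (Manifold.riemannianEDist J x.2 y.2).toReal ^ 2) ≤
    Manifold.riemannianEDist (I.prod J) x y := by
  let _ := prodRiemannianBundle I A J B c hc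
  obtain ⟨a, ha⟩ : ∃ a, a = (Manifold.riemannianEDist I x.1 y.1).toReal := ⟨_, rfl⟩
  obtain ⟨b, hb⟩ : ∃ b, b = (Manifold.riemannianEDist J x.2 y.2).toReal := ⟨_, rfl⟩
  obtain ⟨D, hD⟩ : ∃ D, D = √(c * a ^ 2 + b ^ 2) := ⟨_, rfl⟩
  have ha0 : 0 ≤ a := ha ▸ ENNReal.toReal_nonneg
  have hb0 : 0 ≤ b := hb ▸ ENNReal.toReal_nonneg
  rw [← ha, ← hb, ← hD]
  have hD0 : 0 ≤ D := hD ▸ Real.sqrt_nonneg _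
  rcases hD0.eq_or_lt with h0 | hpos
  · simp [← h0]
  have hDsq : D ^ 2 = c * a ^ 2 + b ^ 2 := by rw [hD, Real.sq_sqrt (by positivity)]
  refine le_of_forall_gt fun r hr => ?_
  obtain ⟨ζ, h0, h1, hζ, hlen, -, -⟩ :=
    Manifold.exists_lt_locally_constant_of_riemannianEDist_lt hr zero_lt_one
  obtain ⟨γ, hγdef⟩ : ∃ γ : ℝ → A, γ = fun t => (ζ t).1 := ⟨_, rfl⟩
  obtain ⟨η, hηdef⟩ : ∃ η : ℝ → B, η = fun t => (ζ t).2 := ⟨_, rfl⟩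
  have hγ : ContMDiff 𝓘(ℝ, ℝ) I 1 γ := hγdef ▸ contMDiff_fst.comp hζ
  have hη : ContMDiff 𝓘(ℝ, ℝ) J 1 η := hηdef ▸ contMDiff_snd.comp hζ
  obtain rfl : ζ = fun t => (γ t, η t) := by rw [hγdef, hηdef]
  refine lt_of_le_of_lt ?_ hlen
  have hA : Manifold.riemannianEDist I x.1 y.1 ≤ Manifold.pathELength I γ 0 1 :=
    Manifold.riemannianEDist_le_pathELength hγ.contMDiffOn (by rw [← h0]) (by rw [← h1])
      zero_le_one
  have hB : Manifold.riemannianEDist J x.2 y.2 ≤ Manifold.pathELength J η 0 1 :=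
    Manifold.riemannianEDist_le_pathELength hη.contMDiffOn (by rw [← h0]) (by rw [← h1])
      zero_le_one
  rw [Manifold.pathELength_eq_lintegral_mfderiv_Icc] at hA hB ⊢
  -- The functional dual to the vector `(a, b)`, of norm one.
  have hsplit : ENNReal.ofReal D = ENNReal.ofReal (c * a / D) * Manifold.riemannianEDist I x.1 y.1 +
      ENNReal.ofReal (b / D) * Manifold.riemannianEDist J x.2 y.2 := by
    rw [← ENNReal.ofReal_toReal hx, ← ENNReal.ofReal_toReal hy, ← ha, ← hb,
      ← ENNReal.ofReal_mul (by positivity), ← ENNReal.ofReal_mul (by positivity),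
      ← ENNReal.ofReal_add (by positivity) (by positivity)]
    congr 1
    field_simp
    linarith
  rw [hsplit]
  calc _ ≤ ENNReal.ofReal (c * a / D) * (∫⁻ t in Icc (0 : ℝ) 1, ‖mfderiv 𝓘(ℝ, ℝ) I γ t 1‖ₑ) +
        ENNReal.ofReal (b / D) * (∫⁻ t in Icc (0 : ℝ) 1, ‖mfderiv 𝓘(ℝ, ℝ) J η t 1‖ₑ) := by
        gcongr
    _ = (∫⁻ t in Icc (0 : ℝ) 1, ENNReal.ofReal (c * a / D) * ‖mfderiv 𝓘(ℝ, ℝ) I γ t 1‖ₑ) +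
        ∫⁻ t in Icc (0 : ℝ) 1, ENNReal.ofReal (b / D) * ‖mfderiv 𝓘(ℝ, ℝ) J η t 1‖ₑ := by
        rw [lintegral_const_mul' _ _ ENNReal.ofReal_ne_top,
          lintegral_const_mul' _ _ ENNReal.ofReal_ne_top]
    _ ≤ _ := le_lintegral_add _ _
    _ ≤ _ := lintegral_mono fun t => ?_
  obtain ⟨p, hp⟩ : ∃ p, p = ‖(mfderiv 𝓘(ℝ, ℝ) I γ t 1 : TangentSpace I (γ t))‖ := ⟨_, rfl⟩
  obtain ⟨q, hq⟩ : ∃ q, q = ‖(mfderiv 𝓘(ℝ, ℝ) J η t 1 : TangentSpace J (η t))‖ := ⟨_, rfl⟩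
  have hp0 : 0 ≤ p := hp ▸ norm_nonneg _
  have hq0 : 0 ≤ q := hq ▸ norm_nonneg _
  have e1 : ‖(mfderiv 𝓘(ℝ, ℝ) I γ t 1 : TangentSpace I (γ t))‖ₑ = ENNReal.ofReal p := by
    rw [hp, ofReal_norm]
  have e2 : ‖(mfderiv 𝓘(ℝ, ℝ) J η t 1 : TangentSpace J (η t))‖ₑ = ENNReal.ofReal q := by
    rw [hq, ofReal_norm]
  have e3 : ‖(mfderiv 𝓘(ℝ, ℝ) (I.prod J) (fun s => (γ s, η s)) t 1 :
      TangentSpace (I.prod J) (γ t, η t))‖ₑ = ENNReal.ofReal √(c * p ^ 2 + q ^ 2) := by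
    rw [hp, hq, ← speed_prod_eq c hc hγ hη t, ofReal_norm]
  change ENNReal.ofReal (c * a / D) * ‖(mfderiv 𝓘(ℝ, ℝ) I γ t 1 : TangentSpace I (γ t))‖ₑ +
    ENNReal.ofReal (b / D) * ‖(mfderiv 𝓘(ℝ, ℝ) J η t 1 : TangentSpace J (η t))‖ₑ ≤
    ‖(mfderiv 𝓘(ℝ, ℝ) (I.prod J) (fun s => (γ s, η s)) t 1 :
      TangentSpace (I.prod J) (γ t, η t))‖ₑ
  rw [e1, e2, e3, ← ENNReal.ofReal_mul (by positivity), ← ENNReal.ofReal_mul (by positivity),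
      ← ENNReal.ofReal_add (by positivity) (by positivity)]
  refine ENNReal.ofReal_le_ofReal (Real.le_sqrt_of_sq_le ?_)
  have e : c * a / D * p + b / D * q = (c * a * p + b * q) / D := by ring
  rw [e, div_pow, div_le_iff₀ (by positivity), hDsq]
  nlinarith [mul_nonneg hc.le (sq_nonneg (a * q - b * p))]

/-- Almost shortest paths in the factors, parametrized with almost constant speed, form an almost
shortest path in the product. -/
lemma riemannianEDist_prod_le_sqrt (c : ℝ) (hc : 0 < c) (x y : A × B)
    (hx : Manifold.riemannianEDist I x.1 y.1 ≠ ⊤) (hy : Manifold.riemannianEDist J x.2 y.2 ≠ ⊤) :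
    letI := prodRiemannianBundle I A J B c hc
    Manifold.riemannianEDist (I.prod J) x y ≤
    ENNReal.ofReal √(c * (Manifold.riemannianEDist I x.1 y.1).toReal ^ 2 +
      (Manifold.riemannianEDist J x.2 y.2).toReal ^ 2) := by
  let _ := prodRiemannianBundle I A J B c hc
  obtain ⟨a, ha⟩ : ∃ a, a = (Manifold.riemannianEDist I x.1 y.1).toReal := ⟨_, rfl⟩
  obtain ⟨b, hb⟩ : ∃ b, b = (Manifold.riemannianEDist J x.2 y.2).toReal := ⟨_, rfl⟩
  have ha0 : 0 ≤ a := ha ▸ ENNReal.toReal_nonneg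
  have hb0 : 0 ≤ b := hb ▸ ENNReal.toReal_nonneg
  rw [← ha, ← hb]
  have key : ∀ ε > 0, Manifold.riemannianEDist (I.prod J) x y ≤
      ENNReal.ofReal √(c * (a + ε) ^ 2 + (b + ε) ^ 2) := by
    intro ε hε
    obtain ⟨γ, hγ0, hγ1, hγ, hγv⟩ := exists_path_speed_le (I := I) (x := x.1) (y := y.1)
      (r := a + ε) (by
        rw [← ENNReal.ofReal_toReal hx, ← ha]
        exact (ENNReal.ofReal_lt_ofReal_iff (by positivity)).2 (by linarith))
    obtain ⟨η, hη0, hη1, hη, hηv⟩ := exists_path_speed_le (I := J) (x := x.2) (y := y.2)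
      (r := b + ε) (by
        rw [← ENNReal.ofReal_toReal hy, ← hb]
        exact (ENNReal.ofReal_lt_ofReal_iff (by positivity)).2 (by linarith))
    refine (Manifold.riemannianEDist_le_pathELength (γ := fun s => (γ s, η s)) (a := 0) (b := 1)
      (hγ.prodMk hη).contMDiffOn (by rw [hγ0, hη0]) (by rw [hγ1, hη1]) zero_le_one).trans ?_
    rw [Manifold.pathELength_eq_lintegral_mfderiv_Icc]
    refine (lintegral_mono (g := fun _ => ENNReal.ofReal √(c * (a + ε) ^ 2 + (b + ε) ^ 2))
      fun t => ?_).trans_eq (by simp)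
    have e3 : ‖(mfderiv 𝓘(ℝ, ℝ) (I.prod J) (fun s => (γ s, η s)) t 1 :
        TangentSpace (I.prod J) (γ t, η t))‖ₑ ≤ ENNReal.ofReal √(c * (a + ε) ^ 2 + (b + ε) ^ 2) := by
      rw [← ofReal_norm, speed_prod_eq c hc hγ hη t]
      have h1 := hγv t
      have h2 := hηv t
      gcongr
    exact e3
  have hlim : Tendsto (fun ε : ℝ => ENNReal.ofReal √(c * (a + ε) ^ 2 + (b + ε) ^ 2)) (𝓝[>] 0)
      (𝓝 (ENNReal.ofReal √(c * a ^ 2 + b ^ 2))) := by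
    have : Continuous fun ε : ℝ => ENNReal.ofReal √(c * (a + ε) ^ 2 + (b + ε) ^ 2) :=
      ENNReal.continuous_ofReal.comp (by fun_prop)
    have h := this.tendsto 0
    simp only [add_zero] at h
    exact h.mono_left nhdsWithin_le_nhds
  refine ge_of_tendsto hlim ?_
  filter_upwards [self_mem_nhdsWithin] with ε hε using key ε hε

end ProductDistance

/-! ### Finite powers of Riemannian manifolds -/

/-- This serves to transport structures along `modelWithCornersSelf_prod`. -/
lemma isFiniteDimensionalRiemannian_of_model {E : Type} [NormedAddCommGroup E] [NormedSpace ℝ E]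
    [FiniteDimensional ℝ E] {I : ModelWithCorners ℝ E E} (hI : I = 𝓘(ℝ, E)) {N : Type*}
    [EMetricSpace N] [ChartedSpace E N] [IsManifold I ∞ N]
    [Bundle.RiemannianBundle (fun x : N => TangentSpace I x)]
    [IsContMDiffRiemannianBundle I ∞ E (fun x : N => TangentSpace I x)]
    [IsRiemannianManifold I N] : IsFiniteDimensionalRiemannian N := by
  subst hI
  exact ⟨E, ‹_›, ‹_›, ‹_›, ‹_›, ‹_›, ‹_›, ‹_›, ‹_›⟩

/-- The one-point space, as a zero-dimensional Riemannian manifold. -/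
lemma isFiniteDimensionalRiemannian_punit :
    IsFiniteDimensionalRiemannian PUnit.{u + 1} := by
  let E := EuclideanSpace ℝ (Fin 0)
  let _ : ChartedSpace E PUnit.{u + 1} := ChartedSpace.ofDiscreteTopology
  have : IsManifold 𝓘(ℝ, E) ∞ PUnit.{u + 1} := IsManifold.of_discreteTopology _
  let g : Bundle.ContMDiffRiemannianMetric 𝓘(ℝ, E) ∞ E
      (fun x : PUnit.{u + 1} => TangentSpace 𝓘(ℝ, E) x) :=
    { inner := fun _ => (0 : E →L[ℝ] E →L[ℝ] ℝ)
      symm := fun _ _ _ => rfl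
      pos := fun _ v hv => absurd (Subsingleton.elim (α := E) v 0) hv
      isVonNBounded := fun _ => (Set.toFinite (_ : Set E)).isVonNBounded
      contMDiff := contMDiff_of_discreteTopology }
  let _ : Bundle.RiemannianBundle (fun x : PUnit.{u + 1} => TangentSpace 𝓘(ℝ, E) x) :=
    ⟨g.toRiemannianMetric⟩
  exact ⟨E, inferInstance, inferInstance, inferInstance, ‹_›, ‹_›, ‹_›, inferInstance,
    ⟨fun x y => by rw [Subsingleton.elim x y, edist_self, Manifold.riemannianEDist_self]⟩⟩

/-- The product of two Riemannian manifolds, with one of the factors rescaled by `√c`. -/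
lemma exists_riemannian_prod {A : Type u} [EMetricSpace A] (hA : IsFiniteDimensionalRiemannian A)
    {B : Type v} [EMetricSpace B] (hB : IsFiniteDimensionalRiemannian B)
    (hA' : ∀ x y : A, edist x y ≠ ⊤) (hB' : ∀ x y : B, edist x y ≠ ⊤) {c : ℝ} (hc : 0 < c) :
    ∃ m : EMetricSpace (A × B), @IsFiniteDimensionalRiemannian (A × B) m ∧
      ∀ x y : A × B, m.edist x y = ENNReal.ofReal
        √(c * (edist x.1 y.1).toReal ^ 2 + (edist x.2 y.2).toReal ^ 2) := by
  obtain ⟨E, _, _, _, _, _, _, _, hdA⟩ := hA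
  obtain ⟨F, _, _, _, _, _, _, _, hdB⟩ := hB
  let _ := prodRiemannianBundle 𝓘(ℝ, E) A 𝓘(ℝ, F) B c hc
  have h1 : IsContMDiffRiemannianBundle (𝓘(ℝ, E).prod 𝓘(ℝ, F)) ∞ (E × F)
      (fun x : A × B => TangentSpace (𝓘(ℝ, E).prod 𝓘(ℝ, F)) x) := inferInstance
  have h2 := isContinuousRiemannianBundle_of_isContMDiff (I := 𝓘(ℝ, E).prod 𝓘(ℝ, F)) (A := A × B)
  have h3 : IsManifold (𝓘(ℝ, E).prod 𝓘(ℝ, F)) 1 (A × B) := .of_le (n := ∞) (by simp)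
  refine ⟨EMetricSpace.ofRiemannianMetric (𝓘(ℝ, E).prod 𝓘(ℝ, F)) (A × B), ?_, fun x y => ?_⟩
  · let m := EMetricSpace.ofRiemannianMetric (𝓘(ℝ, E).prod 𝓘(ℝ, F)) (A × B)
    -- Otherwise the supremum metric of the product would be found.
    let _ : PseudoEMetricSpace (A × B) := m.toPseudoEMetricSpace
    let _ : ChartedSpace (E × F) (A × B) := prodChartedSpace E A F B
    let I : ModelWithCorners ℝ (E × F) (E × F) := 𝓘(ℝ, E).prod 𝓘(ℝ, F)
    have h4 : IsManifold I ∞ (A × B) :=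
      inferInstanceAs (IsManifold (𝓘(ℝ, E).prod 𝓘(ℝ, F)) ∞ (A × B))
    let _ : Bundle.RiemannianBundle (fun x : A × B => TangentSpace I x) :=
      prodRiemannianBundle 𝓘(ℝ, E) A 𝓘(ℝ, F) B c hc
    have h5 : IsContMDiffRiemannianBundle I ∞ (E × F) (fun x : A × B => TangentSpace I x) := h1
    have h6 : IsRiemannianManifold I (A × B) := ⟨fun x y => rfl⟩
    exact isFiniteDimensionalRiemannian_of_model (I := I) modelWithCornersSelf_prod.symm
  · have ea := hdA.out x.1 y.1
    have eb := hdB.out x.2 y.2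
    have ha := hA' x.1 y.1
    have hb := hB' x.2 y.2
    rw [ea] at ha
    rw [eb] at hb
    rw [ea, eb]
    exact le_antisymm (riemannianEDist_prod_le_sqrt c hc x y ha hb)
      (sqrt_le_riemannianEDist_prod c hc x y ha hb)

/-- A finite power of a Riemannian manifold, with the metric `(∑ wⱼ d²)^(1/2)`, is a Riemannian
manifold. -/
lemma exists_riemannian_pi {S : Type u} [MetricSpace S] {N : Type u} [EMetricSpace N]
    (hN : IsFiniteDimensionalRiemannian N) (e : S ≃ᵢ N) (k : ℕ) (w : Fin k → ℝ)
    (hw : ∀ j, 0 < w j) :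
    ∃ (N' : Type (max u v)) (_ : EMetricSpace N') (φ : (Fin k → S) ≃ N'),
      IsFiniteDimensionalRiemannian N' ∧
      ∀ f g, edist (φ f) (φ g) = ENNReal.ofReal √(∑ j, w j * dist (f j) (g j) ^ 2) := by
  induction k with
  | zero =>
    exact ⟨PUnit.{max u v + 1}, inferInstance, Equiv.ofUnique _ _,
      isFiniteDimensionalRiemannian_punit, fun f g => by simp⟩
  | succ k ih =>
    obtain ⟨N', _, φ, hN', hφ⟩ := ih (fun j => w j.succ) fun j => hw _
    have h1 : ∀ x y : N, edist x y ≠ ⊤ := fun x y => by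
      rw [← e.symm.edist_eq]; exact edist_ne_top _ _
    have h2 : ∀ x y : N', edist x y ≠ ⊤ := fun x y => by
      rw [← φ.apply_symm_apply x, ← φ.apply_symm_apply y, hφ]
      exact ENNReal.ofReal_ne_top
    obtain ⟨m, hm, hd⟩ := exists_riemannian_prod hN hN' h1 h2 (hw 0)
    refine ⟨N × N', m, (Fin.consEquiv fun _ => S).symm.trans (e.toEquiv.prodCongr φ), hm,
      fun f g => (hd _ _).trans ?_⟩
    have h3 : (edist (e (f 0)) (e (g 0))).toReal = dist (f 0) (g 0) := by
      rw [e.edist_eq, edist_dist, ENNReal.toReal_ofReal dist_nonneg]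
    have h4 : (edist (φ (Fin.tail f)) (φ (Fin.tail g))).toReal ^ 2
        = ∑ j : Fin k, w j.succ * dist (f j.succ) (g j.succ) ^ 2 := by
      have : 0 ≤ ∑ j : Fin k, w j.succ * dist (f j.succ) (g j.succ) ^ 2 :=
        Finset.sum_nonneg fun j _ => mul_nonneg (hw _).le (sq_nonneg _)
      rw [hφ, ENNReal.toReal_ofReal (Real.sqrt_nonneg _)]
      exact Real.sq_sqrt this
    rw [Fin.sum_univ_succ, ← h4, ← h3]
    rfl

/-! ### Step maps subordinate to a finite partition -/

namespace ContinuumProduct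

section StepMaps

variable {Y : Type*} [MeasurableSpace Y] {μ : Measure Y} {X : Type*} [MetricSpace X]

lemma memL2_simpleFunc [IsFiniteMeasure μ] [Nonempty X] (f : SimpleFunc Y X) : MemL2 μ f := by
  refine ⟨f.stronglyMeasurable.aestronglyMeasurable, Classical.arbitrary X, ?_⟩
  exact SimpleFunc.integrable_of_isFiniteMeasure (μ := μ)
    (f.map fun x => dist x (Classical.arbitrary X) ^ 2)

variable {J : Type*} [Fintype J] [MeasurableSpace J] [MeasurableSingletonClass J] {q : Y → J}

lemma memL2_comp [IsFiniteMeasure μ] [Nonempty X] (hq : Measurable q) (F : J → X) :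
    MemL2 μ (F ∘ q) :=
  memL2_simpleFunc ((SimpleFunc.ofFinite F).comp q hq)

variable (μ) in
/-- The classes of maps with values in `S` that are constant on the sets `q = j`, for a measurable
map `q` with finite range. -/
def stepMaps (q : Y → J) (S : Set X) : Set (ContinuumProduct μ X) :=
  {ξ | ∃ F : J → X, (∀ j, F j ∈ S) ∧ ξ.1 =ᵐ[μ] F ∘ q}

lemma dist_sq_of_ae_eq_comp [IsFiniteMeasure μ] (hq : Measurable q) {ξ η : ContinuumProduct μ X}
    {F G : J → X} (hξ : ξ.1 =ᵐ[μ] F ∘ q) (hη : η.1 =ᵐ[μ] G ∘ q) :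
    dist ξ η ^ 2 = ∑ j, μ.real (q ⁻¹' {j}) * dist (F j) (G j) ^ 2 := by
  have h1 : dist ξ η ^ 2 = ∫ y, dist (F (q y)) (G (q y)) ^ 2 ∂μ := by
    rw [dist_sq_eq]
    refine integral_congr_ae ?_
    filter_upwards [hξ, hη] with y h1 h2
    rw [h1, h2]
    rfl
  rw [h1, ← integral_map (f := fun j => dist (F j) (G j) ^ 2) hq.aemeasurable
    (Measurable.of_discrete.aestronglyMeasurable), integral_fintype .of_finite]
  refine Finset.sum_congr rfl fun j _ => ?_
  rw [map_measureReal_apply hq (measurableSet_singleton j), smul_eq_mul]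

/-- Step maps with values in `S` form a finite power of `S` with a weighted `ℓ²`-metric, one factor
for each set of positive measure in the partition. -/
lemma exists_parametrization_stepMaps [IsFiniteMeasure μ] (hq : Measurable q) {S : Set X}
    (hS : S.Nonempty) :
    ∃ (k : ℕ) (w : Fin k → ℝ) (Ψ : (Fin k → S) → ContinuumProduct μ X), (∀ j, 0 < w j) ∧
      (∀ f g, dist (Ψ f) (Ψ g) = √(∑ j, w j * dist (f j) (g j) ^ 2)) ∧
      range Ψ = stepMaps μ q S := by
  classical
  obtain ⟨x₀, hx₀⟩ := hS
  have : Nonempty X := ⟨x₀⟩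
  -- Sets of measure zero are omitted; there the values of the map are irrelevant.
  let J' := {j : J // 0 < μ.real (q ⁻¹' {j})}
  let σ : Fin (Fintype.card J') ≃ J' := (Fintype.equivFin J').symm
  let extend (f : Fin (Fintype.card J') → S) (j : J) : X :=
    if h : 0 < μ.real (q ⁻¹' {j}) then (f (σ.symm ⟨j, h⟩) : X) else x₀
  have hext (f) (i) : extend f (σ i).1 = f i := by
    simp only [extend, dif_pos (σ i).2]
    exact congrArg (fun i => (f i : X)) (σ.symm_apply_apply i)
  have hdist {ξ η : ContinuumProduct μ X} {F G : J → X} (hξ : ξ.1 =ᵐ[μ] F ∘ q)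
      (hη : η.1 =ᵐ[μ] G ∘ q) : dist ξ η ^ 2 =
        ∑ i, μ.real (q ⁻¹' {(σ i).1}) * dist (F (σ i).1) (G (σ i).1) ^ 2 := by
    rw [dist_sq_of_ae_eq_comp hq hξ hη,
      σ.sum_comp (fun j : J' => μ.real (q ⁻¹' {j.1}) * dist (F j.1) (G j.1) ^ 2),
      ← Finset.sum_subtype (Finset.univ.filter fun j => 0 < μ.real (q ⁻¹' {j})) (by simp)
        (fun j => μ.real (q ⁻¹' {j}) * dist (F j) (G j) ^ 2)]
    refine (Finset.sum_filter_of_ne fun j _ hj => ?_).symm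
    exact measureReal_nonneg.lt_of_ne' (left_ne_zero_of_mul hj)
  refine ⟨_, fun i => μ.real (q ⁻¹' {(σ i).1}), fun f => ofFun _ (memL2_comp hq (extend f)),
    fun i => (σ i).2, fun f g => ?_, ?_⟩
  · rw [← Real.sqrt_sq dist_nonneg, hdist (coeFn_ofFun _ _) (coeFn_ofFun _ _)]
    simp only [hext]
    rfl
  · refine Subset.antisymm ?_ ?_
    · rintro _ ⟨f, rfl⟩
      refine ⟨extend f, fun j => ?_, coeFn_ofFun _ _⟩
      by_cases h : 0 < μ.real (q ⁻¹' {j})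
      · simp only [extend, dif_pos h]
        exact Subtype.coe_prop _
      · simpa only [extend, dif_neg h] using hx₀
    · rintro ξ ⟨F, hF, hξ⟩
      refine ⟨fun i => ⟨F (σ i).1, hF _⟩, ?_⟩
      refine dist_eq_zero.1 (pow_eq_zero_iff two_ne_zero |>.1 ?_)
      rw [hdist (coeFn_ofFun _ _) hξ]
      refine Finset.sum_eq_zero fun i _ => ?_
      rw [show extend (fun i => ⟨F (σ i).1, hF _⟩) (σ i).1 = F (σ i).1 from
        hext (fun i => (⟨F (σ i).1, hF _⟩ : S)) i]
      simp

variable {k : ℕ} {w : Fin k → ℝ} {S : Set X} {Ψ : (Fin k → S) → ContinuumProduct μ X}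
  [IsFiniteMeasure μ]

/-- The weighted `ℓ²`-metric on `Fin k → S` is equivalent to the supremum metric, hence complete. -/
lemma isClosed_range_of_dist_eq [CompleteSpace X] (hS : IsClosed S) (hw : ∀ j, 0 < w j)
    (hΨ : ∀ f g, dist (Ψ f) (Ψ g) = √(∑ j, w j * dist (f j) (g j) ^ 2)) :
    IsClosed (range Ψ) := by
  have := hS.completeSpace_coe
  obtain ⟨K, hK⟩ : ∃ K : NNReal, ∀ j, 1 ≤ (K : ℝ) ^ 2 * w j := by
    have h1 : ∀ᶠ r : ℝ in atTop, ∀ j, 1 ≤ r ^ 2 * w j := eventually_all.2 fun j =>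
      ((tendsto_pow_atTop two_ne_zero).atTop_mul_const (hw j)).eventually_ge_atTop 1
    obtain ⟨r, hr, h0⟩ := (h1.and (eventually_ge_atTop 0)).exists
    exact ⟨⟨r, h0⟩, hr⟩
  have h2 : AntilipschitzWith K Ψ := .of_le_mul_dist fun f g => by
    refine (dist_pi_le_iff (by positivity)).2 fun j => ?_
    have hj : w j * dist (f j) (g j) ^ 2 ≤ dist (Ψ f) (Ψ g) ^ 2 := by
      rw [hΨ, Real.sq_sqrt (Finset.sum_nonneg fun j _ => mul_nonneg (hw j).le (sq_nonneg _))]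
      exact Finset.single_le_sum (f := fun j => w j * dist (f j) (g j) ^ 2)
        (fun j _ => mul_nonneg (hw j).le (sq_nonneg _)) (Finset.mem_univ j)
    refine abs_le_of_sq_le_sq' ?_ (by positivity) |>.2
    calc dist (f j) (g j) ^ 2 ≤ (K ^ 2 * w j) * dist (f j) (g j) ^ 2 :=
          le_mul_of_one_le_left (sq_nonneg _) (hK j)
      _ = K ^ 2 * (w j * dist (f j) (g j) ^ 2) := by ring
      _ ≤ K ^ 2 * dist (Ψ f) (Ψ g) ^ 2 := by gcongr
      _ = _ := by ring
  have h3 : LipschitzWith (√(∑ j, w j)).toNNReal Ψ := .of_dist_le_mul fun f g => by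
    rw [Real.coe_toNNReal _ (Real.sqrt_nonneg _), hΨ, ← Real.sqrt_sq (dist_nonneg (x := f)),
      ← Real.sqrt_mul (Finset.sum_nonneg fun j _ => (hw j).le), Finset.sum_mul]
    refine Real.sqrt_le_sqrt (Finset.sum_le_sum fun j _ => ?_)
    have := (hw j).le
    gcongr
    exact dist_le_pi_dist f g j
  exact h2.isClosed_range h3.uniformContinuous

lemma isGeodesicSpace_range_of_dist_eq (hS : IsGeodesicSpace S)
    (hΨ : ∀ f g, dist (Ψ f) (Ψ g) = √(∑ j, w j * dist (f j) (g j) ^ 2)) :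
    IsGeodesicSpace (range Ψ) := by
  rw [isGeodesicSpace_iff] at hS ⊢
  rintro ⟨_, f, rfl⟩ ⟨_, g, rfl⟩
  choose c hc using fun j => hS (f j) (g j)
  refine ⟨fun t => ⟨Ψ fun j => c j t, mem_range_self _⟩, ?_, ?_, fun s hs t ht => ?_⟩
  · exact Subtype.ext (congrArg Ψ (funext fun j => (hc j).zero))
  · exact Subtype.ext (congrArg Ψ (funext fun j => (hc j).one))
  · change dist (Ψ _) (Ψ _) = |s - t| * dist (Ψ f) (Ψ g)
    rw [hΨ, hΨ, ← Real.sqrt_sq (abs_nonneg (s - t)), ← Real.sqrt_mul (sq_nonneg _),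
      Finset.mul_sum]
    congr 1
    refine Finset.sum_congr rfl fun j _ => ?_
    rw [(hc j).dist_eq s hs t ht]
    ring

end StepMaps

section

variable {Y : Type v} [MeasurableSpace Y] {μ : Measure Y} {X : Type u} [MetricSpace X]
  {k : ℕ} {w : Fin k → ℝ} {S : Set X} {Ψ : (Fin k → S) → ContinuumProduct μ X}
  [IsFiniteMeasure μ]

lemma exists_riemannian_range_of_dist_eq {N : Type u} [EMetricSpace N]
    (hN : IsFiniteDimensionalRiemannian N) (e : S ≃ᵢ N) (hw : ∀ j, 0 < w j)
    (hΨ : ∀ f g, dist (Ψ f) (Ψ g) = √(∑ j, w j * dist (f j) (g j) ^ 2)) :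
    ∃ (N' : Type (max u v)) (_ : EMetricSpace N'),
      IsFiniteDimensionalRiemannian N' ∧ Nonempty (range Ψ ≃ᵢ N') := by
  obtain ⟨N', _, φ, hN', hφ⟩ := exists_riemannian_pi.{u, v} hN e k w hw
  have hiso (f g) : edist (φ f) (φ g) = edist (Ψ f) (Ψ g) := by rw [hφ, edist_dist, hΨ]
  refine ⟨N', ‹_›, hN', ⟨(IsometryEquiv.mk' (fun x => (⟨Ψ (φ.symm x), mem_range_self _⟩ : range Ψ))
    (fun y => φ y.2.choose) ?_ ?_).symm⟩⟩
  · rintro ⟨_, f, rfl⟩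
    refine Subtype.ext ?_
    simp only [Equiv.symm_apply_apply]
    exact Exists.choose_spec (p := fun g => Ψ g = Ψ f) _
  · intro x y
    change edist (Ψ _) (Ψ _) = _
    rw [← hiso, φ.apply_symm_apply, φ.apply_symm_apply]

end

end ContinuumProduct

/-! ### Gluing maps along measurable sets -/

namespace ContinuumProduct

section Density

variable {Y : Type*} [MeasurableSpace Y] {μ : Measure Y} [IsFiniteMeasure μ] {X : Type*}
  [MetricSpace X]

lemma memL2_piecewise {s : Set Y} [∀ y, Decidable (y ∈ s)] (hs : MeasurableSet s) {f g : Y → X}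
    (hf : MemL2 μ f) (hg : MemL2 μ g) : MemL2 μ (s.piecewise f g) := by
  refine MemL2.of_dist (hf.1.restrict.piecewise hs hg.1.restrict) hg ?_
  have h1 : MemLp (fun y => dist (f y) (g y)) 2 μ :=
    (memLp_two_iff_integrable_sq (hf.1.dist hg.1)).2 (hf.integrable_dist_sq hg)
  refine (h1.indicator hs).ae_eq (Eventually.of_forall fun y => ?_)
  by_cases hy : y ∈ s <;> simp [hy]

open Classical in
/-- The map that agrees with `ξ` on `s` and with `η` off `s`. -/
def piecewise {s : Set Y} (hs : MeasurableSet s) (ξ η : ContinuumProduct μ X) :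
    ContinuumProduct μ X :=
  ofFun (s.piecewise ξ.1 η.1) (memL2_piecewise hs ξ.memL2 η.memL2)

open Classical in
lemma coeFn_piecewise {s : Set Y} (hs : MeasurableSet s) (ξ η : ContinuumProduct μ X) :
    (piecewise hs ξ η).1 =ᵐ[μ] s.piecewise ξ.1 η.1 :=
  coeFn_ofFun _ _

lemma dist_piecewise_sq_le {s : Set Y} (hs : MeasurableSet s) (ξ η ξ' η' : ContinuumProduct μ X) :
    dist (piecewise hs ξ η) (piecewise hs ξ' η') ^ 2 ≤ dist ξ ξ' ^ 2 + dist η η' ^ 2 := by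
  classical
  rw [dist_sq_eq, dist_sq_eq, dist_sq_eq,
    ← integral_add (integrable_dist_sq ξ ξ') (integrable_dist_sq η η')]
  refine integral_mono_ae (integrable_dist_sq _ _)
    ((integrable_dist_sq ξ ξ').add (integrable_dist_sq η η')) ?_
  filter_upwards [coeFn_piecewise hs ξ η, coeFn_piecewise hs ξ' η'] with y h1 h2
  simp only [h1, h2]
  by_cases hy : y ∈ s
  · simp [hy]
  · simp [hy]

lemma continuous_piecewise {s : Set Y} (hs : MeasurableSet s) :
    Continuous (Function.uncurry (piecewise (μ := μ) (X := X) hs)) := by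
  refine (LipschitzWith.of_dist_le_mul (K := 2) fun p q => ?_).continuous
  have h := dist_piecewise_sq_le hs p.1 p.2 q.1 q.2
  have h1 : dist p.1 q.1 ≤ dist p q := le_max_left _ _
  have h2 : dist p.2 q.2 ≤ dist p q := le_max_right _ _
  refine abs_le_of_sq_le_sq' ?_ (by positivity) |>.2
  refine h.trans ?_
  have := pow_le_pow_left₀ dist_nonneg h1 2
  have := pow_le_pow_left₀ dist_nonneg h2 2
  push_cast
  nlinarith [sq_nonneg (dist p q)]

/-- If two maps at bounded distance from each other are glued along sets with a small symmetric
difference, the results are close to each other. -/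
lemma dist_piecewise_piecewise_sq_le {s t : Set Y} (hs : MeasurableSet s) (ht : MeasurableSet t)
    (ξ η : ContinuumProduct μ X) {K : ℝ} (hK : ∀ᵐ y ∂μ, dist (ξ.1 y) (η.1 y) ^ 2 ≤ K) :
    dist (piecewise hs ξ η) (piecewise ht ξ η) ^ 2 ≤ K * μ.real (symmDiff s t) := by
  classical
  have hst : MeasurableSet (symmDiff s t) := hs.symmDiff ht
  have h0 : ∫ y, (symmDiff s t).indicator (fun _ => K) y ∂μ = K * μ.real (symmDiff s t) := by
    rw [integral_indicator_const K hst, smul_eq_mul, mul_comm]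
  rw [dist_sq_eq, ← h0]
  refine integral_mono_ae (integrable_dist_sq _ _) ((integrable_const K).indicator hst) ?_
  filter_upwards [coeFn_piecewise hs ξ η, coeFn_piecewise ht ξ η, hK] with y h1 h2 h3
  simp only [h1, h2]
  by_cases hy : y ∈ s <;> by_cases hy' : y ∈ t
  · simp [hy, hy', Set.mem_symmDiff]
  · simpa [hy, hy', Set.mem_symmDiff] using h3
  · simpa [hy, hy', Set.mem_symmDiff, dist_comm] using h3
  · simp [hy, hy', Set.mem_symmDiff]

/-- Simple maps are dense. -/
lemma mem_of_forall_simpleFunc [Nonempty X] [TopologicalSpace.SeparableSpace X]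
    {C : Set (ContinuumProduct μ X)} (hC : IsClosed C)
    (h : ∀ f : SimpleFunc Y X, ofFun f (memL2_simpleFunc f) ∈ C) (ξ : ContinuumProduct μ X) :
    ξ ∈ C := by
  borelize X
  obtain ⟨f, hf, hξ⟩ := ξ.1.aestronglyMeasurable
  have hf2 : MemL2 μ f := by
    obtain ⟨x, hx⟩ := ξ.2
    refine ⟨hf.aestronglyMeasurable, x, hx.congr ?_⟩
    filter_upwards [hξ] with y hy
    rw [hy]
  obtain rfl : ofFun f hf2 = ξ := ofFun_eq hξ.symm
  obtain ⟨x₀⟩ := ‹Nonempty X›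
  let F := SimpleFunc.approxOn f hf.measurable univ x₀ (mem_univ _)
  refine hC.mem_of_tendsto (b := atTop) (f := fun n => ofFun (F n) (memL2_simpleFunc (F n))) ?_
    (Eventually.of_forall fun n => h (F n))
  have hlim : Tendsto (fun n => ∫ y, dist (F n y) (f y) ^ 2 ∂μ) atTop (𝓝 (∫ _, (0 : ℝ) ∂μ)) := by
    refine tendsto_integral_of_dominated_convergence (fun y => dist x₀ (f y) ^ 2)
      (fun n => ((memL2_simpleFunc (F n)).integrable_dist_sq hf2).1)
      ((memL2_const x₀).integrable_dist_sq hf2) (fun n => Eventually.of_forall fun y => ?_)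
      (Eventually.of_forall fun y => ?_)
    · rw [Real.norm_of_nonneg (sq_nonneg _)]
      have := SimpleFunc.edist_approxOn_le hf.measurable (mem_univ x₀) y n
      rw [edist_dist, edist_dist, ENNReal.ofReal_le_ofReal_iff dist_nonneg] at this
      exact pow_le_pow_left₀ dist_nonneg this 2
    · have := SimpleFunc.tendsto_approxOn hf.measurable (mem_univ x₀) (x := y) (by simp)
      simpa using (tendsto_iff_dist_tendsto_zero.1 this).pow 2
  rw [tendsto_iff_dist_tendsto_zero]
  simp only [integral_zero, ← dist_ofFun_sq (memL2_simpleFunc (F _)) hf2] at hlim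
  simpa [Function.comp_def, Real.sqrt_sq dist_nonneg] using
    (Real.continuous_sqrt.tendsto 0).comp hlim

end Density

/-! ### The exhaustion of the continuum product by step maps -/

section Exhaustion

variable {Y : Type*} [MeasurableSpace Y] {μ : Measure Y} {X : Type*} [MetricSpace X]

/-- The partition generated by the first `n` of the sets `A i`, encoded by the map that sends a point
`y` to the truth values of `y ∈ A i`: its fibres are the sets of the partition. -/
def partitionMap (A : ℕ → Set Y) (n : ℕ) (y : Y) : Fin n → Prop := fun i => y ∈ A i

variable {A : ℕ → Set Y}

lemma measurable_partitionMap (hA : ∀ i, MeasurableSet (A i)) (n : ℕ) :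
    Measurable (partitionMap A n) :=
  measurable_pi_iff.2 fun i => measurableSet_setOfPred.1 (hA i)

omit [MeasurableSpace Y] [MetricSpace X] in
lemma exists_comp_partitionMap_eq {n m : ℕ} (h : n ≤ m) (F : (Fin n → Prop) → X) :
    ∃ G : (Fin m → Prop) → X, range G ⊆ range F ∧ G ∘ partitionMap A m = F ∘ partitionMap A n :=
  ⟨fun j => F fun i => j (Fin.castLE h i), by rintro _ ⟨j, rfl⟩; exact mem_range_self _, rfl⟩

variable {S : ℕ → Set X}

lemma monotone_stepMaps (hS : Monotone S) :
    Monotone fun n => stepMaps μ (partitionMap A n) (S n) := by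
  rintro n m hnm ξ ⟨F, hF, hξ⟩
  obtain ⟨G, hG, hGF⟩ := exists_comp_partitionMap_eq (A := A) hnm F
  refine ⟨G, fun j => ?_, hξ.trans (EventuallyEq.of_eq hGF.symm)⟩
  obtain ⟨i, hi⟩ := hG (mem_range_self j)
  exact hi ▸ hS hnm (hF i)

variable [IsFiniteMeasure μ]

lemma mem_iUnion_stepMaps_piecewise (hS : Monotone S) (hA : ∀ i, MeasurableSet (A i)) (m : ℕ)
    {ξ η : ContinuumProduct μ X} (hξ : ξ ∈ ⋃ n, stepMaps μ (partitionMap A n) (S n))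
    (hη : η ∈ ⋃ n, stepMaps μ (partitionMap A n) (S n)) :
    piecewise (hA m) ξ η ∈ ⋃ n, stepMaps μ (partitionMap A n) (S n) := by
  classical
  have hmono := monotone_stepMaps (μ := μ) (A := A) hS
  obtain ⟨n₁, h₁⟩ := mem_iUnion.1 hξ
  obtain ⟨n₂, h₂⟩ := mem_iUnion.1 hη
  obtain ⟨n, hn⟩ : ∃ n, n = max (m + 1) (max n₁ n₂) := ⟨_, rfl⟩
  have hm : m < n := by omega
  obtain ⟨F, hF, hξ⟩ := hmono (show n₁ ≤ n by omega) h₁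
  obtain ⟨G, hG, hη⟩ := hmono (show n₂ ≤ n by omega) h₂
  refine mem_iUnion.2 ⟨n, fun j => if j ⟨m, hm⟩ then F j else G j, fun j => ?_, ?_⟩
  · dsimp only
    split_ifs
    exacts [hF j, hG j]
  · filter_upwards [hξ, hη, coeFn_piecewise (hA m) ξ η] with y h1 h2 h3
    rw [h3]
    by_cases hy : y ∈ A m
    · simp [hy, h1, partitionMap]
    · simp [hy, h2, partitionMap]

omit [IsFiniteMeasure μ] in
lemma exists_dist_sq_le_of_mem_stepMaps (hS : Monotone S) {ξ η : ContinuumProduct μ X}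
    (hξ : ξ ∈ ⋃ n, stepMaps μ (partitionMap A n) (S n))
    (hη : η ∈ ⋃ n, stepMaps μ (partitionMap A n) (S n)) :
    ∃ K : ℝ, 0 < K ∧ ∀ᵐ y ∂μ, dist (ξ.1 y) (η.1 y) ^ 2 ≤ K := by
  have hmono := monotone_stepMaps (μ := μ) (A := A) hS
  obtain ⟨n₁, h₁⟩ := mem_iUnion.1 hξ
  obtain ⟨n₂, h₂⟩ := mem_iUnion.1 hη
  obtain ⟨F, hF, hξ⟩ := hmono (le_max_left n₁ n₂) h₁
  obtain ⟨G, hG, hη⟩ := hmono (le_max_right n₁ n₂) h₂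
  have hb := (Set.toFinite (range fun j => dist (F j) (G j) ^ 2)).bddAbove
  obtain ⟨K, hK⟩ := hb
  refine ⟨max K 1, by positivity, ?_⟩
  filter_upwards [hξ, hη] with y h1 h2
  rw [h1, h2]
  exact (hK (mem_range_self (partitionMap A _ y))).trans (le_max_left _ _)

/-- If the sets `A i` are measure-dense and the sets `S n` have dense union, then the step maps with
values in `S n` that are constant on the partition generated by the first `n` sets `A i` have dense
union. -/
lemma dense_iUnion_stepMaps [Nonempty X] [TopologicalSpace.SeparableSpace X] (hS : Monotone S)
    (hdense : Dense (⋃ n, S n)) (hA : μ.MeasureDense (range A)) :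
    Dense (⋃ n, stepMaps μ (partitionMap A n) (S n)) := by
  have hAm (i : ℕ) : MeasurableSet (A i) := hA.measurable _ (mem_range_self i)
  let C : Set (ContinuumProduct μ X) := closure (⋃ n, stepMaps μ (partitionMap A n) (S n))
  have hC : IsClosed C := isClosed_closure
  have hconst (x : X) : ofFun _ (memL2_const x) ∈ C := by
    have hcont : Continuous fun x : X => (ofFun (μ := μ) _ (memL2_const (Y := Y) x)) := by
      refine (LipschitzWith.of_dist_le_mul (K := (√(μ.real univ)).toNNReal)
        fun x x' => ?_).continuous
      rw [Real.coe_toNNReal _ (Real.sqrt_nonneg _), ← Real.sqrt_sq (dist_nonneg (x := ofFun _ _)),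
        dist_ofFun_sq, integral_const, smul_eq_mul, Real.sqrt_mul measureReal_nonneg,
        Real.sqrt_sq dist_nonneg]
    refine map_mem_closure hcont (hdense x) fun x hx => ?_
    obtain ⟨n, hn⟩ := mem_iUnion.1 hx
    exact mem_iUnion.2 ⟨n, fun _ => x, fun _ => hn, coeFn_ofFun _ _⟩
  have hpiecewise {s : Set Y} (hs : MeasurableSet s) {ξ η : ContinuumProduct μ X} (hξ : ξ ∈ C)
      (hη : η ∈ C) : piecewise hs ξ η ∈ C := by
    refine hC.closure_subset (map_mem_closure₂ (continuous_piecewise hs) hξ hη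
      fun ξ hξ η hη => Metric.mem_closure_iff.2 fun ε hε => ?_)
    obtain ⟨K, hK0, hK⟩ := exists_dist_sq_le_of_mem_stepMaps hS hξ hη
    obtain ⟨_, ⟨m, rfl⟩, hm⟩ := hA.approx s hs (measure_ne_top μ s) (ε ^ 2 / K) (by positivity)
    refine ⟨_, mem_iUnion_stepMaps_piecewise hS hAm m hξ hη, ?_⟩
    have h1 : μ.real (symmDiff s (A m)) < ε ^ 2 / K := by
      rw [Measure.real]
      exact (ENNReal.toReal_lt_of_lt_ofReal hm)
    refine lt_of_pow_lt_pow_left₀ 2 hε.le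
      ((dist_piecewise_piecewise_sq_le hs (hAm m) ξ η hK).trans_lt ?_)
    rwa [lt_div_iff₀' hK0] at h1
  refine fun ξ => mem_of_forall_simpleFunc hC (fun f => ?_) ξ
  induction f using SimpleFunc.induction' with
  | const c => exact hconst c
  | pcw hs hf hg =>
    rename_i f g s
    classical
    have h := hpiecewise hs hf hg
    refine (congrArg (· ∈ C) (ofFun_eq ?_)).mpr h
    filter_upwards [coeFn_piecewise hs (ofFun f (memL2_simpleFunc f))
      (ofFun g (memL2_simpleFunc g)), coeFn_ofFun f (memL2_simpleFunc f),
      coeFn_ofFun g (memL2_simpleFunc g)] with y h1 h2 h3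
    rw [h1, SimpleFunc.coe_piecewise]
    by_cases hy : y ∈ s <;> simp [hy, Set.piecewise, h2, h3]

end Exhaustion

/-- The exhaustion of `L²(Y, μ, X)` consists of the step maps with values in a subset of the
exhaustion of `X` that are constant on the partition generated by the first few sets of a countable
measure-dense family. -/
theorem isAdmissible {Y : Type v} [MeasurableSpace Y] {μ : Measure Y} [IsFiniteMeasure μ]
    (hμ : IsSeparable μ) {X : Type u} [MetricSpace X] (hX : IsAdmissible X) :
    IsAdmissible (ContinuumProduct μ X) := by
  obtain ⟨hX, hsep, S, hmono, hclosed, hgeod, hriem, hdense⟩ := hX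
  have : Nonempty X := hX.nonempty
  have : CompleteSpace X := hX.complete
  obtain ⟨x, hx⟩ := hdense.nonempty
  obtain ⟨k, hk⟩ := mem_iUnion.1 hx
  -- The first subsets of the exhaustion may be empty, so they are skipped.
  have hne (n : ℕ) : (S (n + k)).Nonempty := ⟨x, hmono (Nat.le_add_left k n) hk⟩
  have hmono' : Monotone fun n => S (n + k) := fun n m h => hmono (by omega)
  have hdense' : Dense (⋃ n, S (n + k)) := hdense.mono
    (iUnion_subset fun n => (hmono (Nat.le_add_right n k)).trans
      (subset_iUnion (fun n => S (n + k)) n))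
  obtain ⟨𝒜, hcount, hA⟩ := hμ.exists_countable_measureDense
  obtain ⟨A, rfl⟩ := hcount.exists_eq_range hA.nonempty
  have hpart := measurable_partitionMap fun i => hA.measurable _ (mem_range_self i)
  have h (n : ℕ) : IsClosed (stepMaps μ (partitionMap A n) (S (n + k))) ∧
      IsGeodesicSpace (stepMaps μ (partitionMap A n) (S (n + k))) ∧
      ∃ (N : Type (max u v)) (_ : EMetricSpace N), IsFiniteDimensionalRiemannian N ∧
        Nonempty (stepMaps μ (partitionMap A n) (S (n + k)) ≃ᵢ N) := by
    obtain ⟨l, w, Ψ, hw, hΨ, hrange⟩ :=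
      exists_parametrization_stepMaps (μ := μ) (hpart n) (hne n)
    obtain ⟨N, _, hN, ⟨e⟩⟩ := hriem (n + k)
    rw [← hrange]
    exact ⟨isClosed_range_of_dist_eq (hclosed _) hw hΨ,
      isGeodesicSpace_range_of_dist_eq (hgeod _) hΨ,
      exists_riemannian_range_of_dist_eq hN e hw hΨ⟩
  exact ⟨isHilbertHadamard hX, separableSpace hμ hsep,
    fun n => stepMaps μ (partitionMap A n) (S (n + k)), monotone_stepMaps hmono',
    fun n => (h n).1, fun n => (h n).2.1, fun n => (h n).2.2,
    dense_iUnion_stepMaps hmono' hdense' hA⟩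

end ContinuumProduct

end HilbertHadamard

end

theorem proposition3 {Y : Type*} [MeasurableSpace Y] (μ : MeasureTheory.Measure Y)
    [MeasureTheory.IsFiniteMeasure μ] {M : Type*} [MetricSpace M]
    (hM : HilbertHadamard.IsHilbertHadamard M) :
    HilbertHadamard.IsHilbertHadamard (HilbertHadamard.ContinuumProduct μ M) ∧
    (MeasureTheory.IsSeparable μ →
      (HilbertHadamard.IsAdmissible M →
        HilbertHadamard.IsAdmissible (HilbertHadamard.ContinuumProduct μ M)) ∧
      (TopologicalSpace.SeparableSpace M →
        TopologicalSpace.SeparableSpace (HilbertHadamard.ContinuumProduct μ M))) := by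
  have : Nonempty M := hM.nonempty
  exact ⟨HilbertHadamard.ContinuumProduct.isHilbertHadamard hM, fun hμ =>
    ⟨HilbertHadamard.ContinuumProduct.isAdmissible hμ,
      HilbertHadamard.ContinuumProduct.separableSpace hμ⟩⟩
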